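/- **Model.** $n\ge 1$ wireless nodes with distinct IDs are placed at points of the plane, at pairwise distances at least $1$; $d(u,v)$ is the distance of $u$ and $v$ and $\Delta$ the largest distance. Let $\alpha>2$ be the path loss exponent, $\beta>0$ the required SINR level, $N>0$ the noise. If exactly the nodes of a set $S$ transmit, $w\in S$ with power $P_w$, then $v$ receives the message of $u\in S$ if $v\notin S$ and $$\frac{P_u/d(u,v)^\alpha}{N+\sum_{w\in S\setminus\{u\}}P_w/d(w,v)^\alpha}\ \ge\ \beta .$$ A link is a pair (sender, receiver) of nodes; its dual is the reversed pair. A set of links, each with a power, is feasible if no two of its links have the same sender and each receiver receives the message of its sender when all these links transmit simultaneously. Mean power gives the link $(u,v)$ the power $\Gamma\, d(u,v)^{\alpha/2}$, where $\Gamma$ is any fixed number with $\Gamma d(u,v)^{\alpha/2}\ge 2\beta N d(u,v)^\alpha$ for all pairs of nodes. Let $\Upsilon=\max(\log\log\Delta,0)+\log n$. A bi-tree is a spanning tree of links directed towards a root, with the dual links, and with a schedule of the links into slots in which every link $(x,y)$ comes after all links of the descendants of $x$, such that for every slot both the set of its links and the set of their duals are feasible. **Initial algorithm** (parameters $p\in(0,\frac12]$,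 $\lambda_1$). All nodes start active. There are $\lfloor\log_2\Delta\rfloor+1$ rounds of $\lceil\lambda_1\log_2 n\rceil$ slot-pairs. In round $r$ all transmissions use power $2\beta N2^{r\alpha}$. In each slot-pair each active node is independently a broadcaster with probability $p$, and otherwise a listener. In the first slot the broadcasters transmit. A listener $v$ that received a message from a broadcaster $u$ with $2^{r-1}\le d(u,v)<2^r$ returns, independently with probability $p$, an acknowledgment to $u$ in the second slot. If $u$ receives an acknowledgment addressed to it, from $v$, then the link $(u,v)$ is formed, $v$ is the parent of $u$, and $u$ becomes inactive. (If there are several candidates for $u$, or for $v$, the one with the smallest ID is taken; this cannot happen if $\beta\ge1$.) $\mathcal T$ is the set of all formed links and their duals; the slot of a formed link is the slot-pair in which it was formed. **Distributed rescheduling** (parameter $\lambda_2$). All links of $\mathcal T$ are pending at first. Phase $k=0,1,2,\dots$ has $2^k\lceil4\lambda_2\log n\rceil$ slot-pairs. In each of them every pending link is drawn independently with probability $\frac1{4\cdot2^k}$; in the first slot a drawn link transmits with mean power unless another drawn link has the same sender; in the second slot each node that received a message addressed to it acknowledges it (the one of the sender with smallest ID, if there are several) on the dual link with mean power. A link whose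 acknowledgment is received is completed, and the slot-pair in which this happens is its new slot. **Theorem.** Let $\alpha>2$, $\beta>0$, $p\in(0,\frac12]$ and $c$ be given. For all sufficiently large $\lambda_1,\lambda_2$ (depending on $\alpha,\beta,p,c$) there is a constant $C$ (depending on $\alpha,\beta,p,c,\lambda_1,\lambda_2$) such that for all $n\ge1$, all placements of the nodes as above, all $N>0$ and all admissible $\Gamma$ there is a number $K$ of slot-pairs with $2K\le C\,\Upsilon\log^3n$ such that, with probability at least $1-n^{-c}$, the initial algorithm constructs a bi-tree $\mathcal T$, and within $K$ slot-pairs the distributed rescheduling completes all links of $\mathcal T$ and partitions them by their new slots into at most $K$ sets that are feasible under mean power. In other words, $\mathcal T$ can be rescheduled, by a distributed algorithm, in $O(\Upsilon\log^3n)$ slots using mean power, with high probability. -/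

import Mathlib

noncomputable section

open scoped Classical

namespace SINR

/-- The result of tossing independent coins, one for each `i : ι`, each showing `true` with
probability `p`. -/
def coins (ι : Type) [Fintype ι] (p : unitInterval) : PMF (ι → Bool) :=
  PMF.ofFintype
    (fun f => ∏ i, cond (f i) (ENNReal.ofReal (p : ℝ)) (ENNReal.ofReal (1 - (p : ℝ))))
    (by
      have h : ∑ b : Bool,
          cond b (ENNReal.ofReal (p : ℝ)) (ENNReal.ofReal (1 - (p : ℝ))) = 1 := by
        rw [Fintype.sum_bool]
        simp only [cond_true, cond_false]
        rw [← ENNReal.ofReal_add p.2.1 (by linarith [p.2.2])]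
        simp
      have key := Finset.prod_univ_sum (fun _ : ι => (Finset.univ : Finset Bool))
        (fun _ b => cond b (ENNReal.ofReal (p : ℝ)) (ENNReal.ofReal (1 - (p : ℝ))))
      rw [Fintype.piFinset_univ] at key
      rw [← key]
      simp only [h, Finset.prod_const_one])

/-- `n` wireless nodes in the plane (the index of a node is its ID), with the path loss exponent
`α`, the required SINR level `β` and the ambient noise `N`. -/
structure Net (n : ℕ) where
  pos : Fin n → EuclideanSpace ℝ (Fin 2)
  α : ℝ
  β : ℝ
  N : ℝ

/-- A link is a pair (sender, receiver). -/
abbrev Link (n : ℕ) := Fin n × Fin n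

variable {n : ℕ}

/-- The distance between two nodes. -/
def Net.d (G : Net n) (u v : Fin n) : ℝ := dist (G.pos u) (G.pos v)

/-- The largest distance between two nodes. -/
def Net.Delta (G : Net n) : ℝ := Metric.diam (Set.range G.pos)

/-- `log log Δ + log n`, where a negative `log log Δ` (that is, `Δ < e`) is replaced by `0`. -/
def Net.Upsilon (G : Net n) : ℝ := max (Real.log (Real.log G.Delta)) 0 + Real.log n

/-- When exactly the nodes in `S` transmit, node `w` with power `P w`, the node `v` is not
transmitting and receives the message of `u ∈ S`. -/
def Net.Receives (G : Net n) (S : Finset (Fin n)) (P : Fin n → ℝ) (u v : Fin n) : Prop :=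
  u ∈ S ∧ v ∉ S ∧
    G.β ≤ (P u / G.d u v ^ G.α) / (G.N + ∑ w ∈ S.erase u, P w / G.d w v ^ G.α)

/-- The set of senders of a link set. -/
def senders (L : Finset (Link n)) : Finset (Fin n) := L.image Prod.fst

/-- The dual of a link set. -/
def dual (L : Finset (Link n)) : Finset (Link n) := L.image Prod.swap

/-- The power spent by node `w` when the links of `L` transmit with powers `pow`; it is only used
for sets `L` with at most one link per sender. -/
def nodePower (pow : Link n → ℝ) (L : Finset (Link n)) (w : Fin n) : ℝ :=
  ∑ l ∈ L with l.1 = w, pow l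

/-- `L` is feasible under the powers `pow`: no node is the sender of two links of `L`, and
every link of `L` succeeds when all links of `L` transmit simultaneously. -/
def Net.Feasible (G : Net n) (pow : Link n → ℝ) (L : Finset (Link n)) : Prop :=
  Set.InjOn Prod.fst (L : Set (Link n)) ∧
    ∀ l ∈ L, G.Receives (senders L) (nodePower pow L) l.1 l.2

/-- Mean power with scale factor `Γ`. -/
def Net.meanPower (G : Net n) (Γ : ℝ) (l : Link n) : ℝ := Γ * G.d l.1 l.2 ^ (G.α / 2)

/-- `A` is a converge-cast tree: a spanning tree directed towards `root`. -/
def IsConvergecast (A : Finset (Link n)) (root : Fin n) : Prop :=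
  (∀ u, u ≠ root → ∃! v, (u, v) ∈ A) ∧ (∀ v, (root, v) ∉ A) ∧
    ∀ u, Relation.ReflTransGen (fun a b => (a, b) ∈ A) u root

/-- The links `A` with their duals form a bi-tree under the schedule `σ`, where link `l` transmits
with power `pow t l` in slot `t`: `A` is a converge-cast tree, every link `(x, y)` is scheduled
after all links of the descendants of `x`, and the slots of the schedule are feasible for `A` and,
used in the opposite order, for the dual links. -/
structure IsBiTree (G : Net n) (A : Finset (Link n)) (σ : Link n → ℕ)
    (pow : ℕ → Link n → ℝ) : Prop where
  tree : ∃ root, IsConvergecast A root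
  order : ∀ x y w z, (x, y) ∈ A → (w, z) ∈ A →
    Relation.TransGen (fun a b => (a, b) ∈ A) w x → σ (w, z) < σ (x, y)
  up : ∀ t, G.Feasible (pow t) {l ∈ A | σ l = t}
  down : ∀ t, G.Feasible (pow t) (dual {l ∈ A | σ l = t})

/-- `σ` schedules the links of `L` in the slots `0, …, K - 1`, each of them feasible. -/
def Net.IsSchedule (G : Net n) (pow : Link n → ℝ) (L : Finset (Link n)) (K : ℕ)
    (σ : Link n → Option ℕ) : Prop :=
  (∀ l ∈ L, ∃ t < K, σ l = some t) ∧ ∀ t < K, G.Feasible pow {l ∈ L | σ l = some t}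

/-- The node with the smallest ID in `s`, if there is one. (If `β ≥ 1`, a node receives at most one
message at a time, and the choice is from at most one node wherever this is used below.) -/
def pick (s : Finset (Fin n)) : Option (Fin n) :=
  if h : s.Nonempty then some (s.min' h) else none

/-! ### Construction of the initial tree -/

/-- A state of the construction: `s u = none` while `u` is active, and `s u = some (t, v)` if the
link `(u, v)` was successfully formed in slot-pair `t`, which made `u` inactive and `v` its
parent. -/
abbrev TreeState (n : ℕ) := Fin n → Option (ℕ × Fin n)

/-- The transmission power in round `r`. -/
def Net.roundPower (G : Net n) (r : ℕ) : ℝ := 2 * G.β * G.N * 2 ^ ((r : ℝ) * G.α)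

/-- The active nodes whose first coin says so are broadcasters. -/
def broadcasters (s : TreeState n) (b : Fin n → Bool) : Finset (Fin n) :=
  {u | s u = none ∧ b u = true}

/-- The broadcaster that `v` acknowledges if it acknowledges one: `v` has to be a listener that
received a message from a node at a distance in `[2^(r-1), 2^r)`. -/
def Net.heard (G : Net n) (r : ℕ) (s : TreeState n) (b : Fin n → Bool) (v : Fin n) :
    Option (Fin n) :=
  if s v = none ∧ b v = false then
    pick {u | G.Receives (broadcasters s b) (fun _ => G.roundPower r) u v ∧
      (2 : ℝ) ^ (r - 1) ≤ G.d u v ∧ G.d u v < (2 : ℝ) ^ r}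
  else none

/-- The nodes that return an acknowledgment: those that heard a message and whose second coin
says so. -/
def Net.ackers (G : Net n) (r : ℕ) (s : TreeState n) (b a : Fin n → Bool) : Finset (Fin n) :=
  {v | (G.heard r s b v).isSome ∧ a v = true}

/-- Slot-pair `t`, which belongs to round `r`: a broadcaster that receives an acknowledgment
addressed to it becomes inactive, with the acknowledging node as its parent. -/
def Net.treeStep (G : Net n) (r t : ℕ) (s : TreeState n) (b a : Fin n → Bool) : TreeState n :=
  fun u =>
    if u ∈ broadcasters s b then
      (pick {v | G.heard r s b v = some u ∧
        G.Receives (G.ackers r s b a) (fun _ => G.roundPower r) v u}).map (fun v => (t, v))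
    else s u

/-- The first `t` slot-pairs, where each round has `m` slot-pairs. -/
def Net.treeRun (G : Net n) (p : unitInterval) (m : ℕ) : ℕ → PMF (TreeState n)
  | 0 => PMF.pure (fun _ => none)
  | t + 1 => (G.treeRun p m t).bind fun s => (coins (Fin n) p).bind fun b =>
      (coins (Fin n) p).bind fun a => PMF.pure (G.treeStep (t / m + 1) t s b a)

/-- The number of slot-pairs per round, `⌈lam * log₂ n⌉`. -/
def pairsPerRound (n : ℕ) (lam : ℝ) : ℕ := ⌈lam * Real.logb 2 n⌉₊

/-- The number of rounds, `⌊log₂ Δ⌋ + 1`. -/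
def Net.rounds (G : Net n) : ℕ := Nat.log 2 ⌊G.Delta⌋₊ + 1

/-- The outcome of the construction. -/
def Net.init (G : Net n) (p : unitInterval) (lam : ℝ) : PMF (TreeState n) :=
  G.treeRun p (pairsPerRound n lam) (G.rounds * pairsPerRound n lam)

/-- The successfully formed links, from a node to its parent. -/
def upLinks (s : TreeState n) : Finset (Link n) := {l | ∃ t, s l.1 = some (t, l.2)}

/-- The slot-pair in which a link was formed. -/
def stamp (s : TreeState n) (l : Link n) : ℕ := (s l.1).elim 0 Prod.fst

/-- The links of the bi-tree: the successfully formed links and their duals. -/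
def treeLinks (s : TreeState n) : Finset (Link n) := upLinks s ∪ dual (upLinks s)

/-! ### Distributed rescheduling of a link set by contention resolution -/

/-- `σ l = some t` if link `l` was completed in slot-pair `t`, and `σ l = none` while `l` is
pending. -/
abbrev SchedState (n : ℕ) := Link n → Option ℕ

/-- The pending links of `T` whose coin says so, provided that no other pending link with the same
sender has such a coin; these links transmit. -/
def transmitting (T : Finset (Link n)) (σ : SchedState n) (b : Link n → Bool) :
    Finset (Link n) :=
  {l ∈ T | (σ l = none ∧ b l = true) ∧
    ∀ l' ∈ T, σ l' = none → b l' = true → l'.1 = l.1 → l' = l}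

/-- The transmitting links whose message is received. -/
def Net.received (G : Net n) (pow : Link n → ℝ) (X : Finset (Link n)) : Finset (Link n) :=
  {l ∈ X | G.Receives (senders X) (nodePower pow X) l.1 l.2}

/-- The links of `Y` that are acknowledged, one for each receiver of `Y`. -/
def acknowledged (Y : Finset (Link n)) : Finset (Link n) :=
  {l ∈ Y | pick {u | (u, l.2) ∈ Y} = some l.1}

/-- The links of `Z` whose acknowledgment is received, when all links dual to those of `Z`
transmit. -/
def Net.confirmed (G : Net n) (pow : Link n → ℝ) (Z : Finset (Link n)) : Finset (Link n) :=
  {l ∈ Z | G.Receives (senders (dual Z)) (nodePower pow (dual Z)) l.2 l.1}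

/-- Slot-pair `t`: the links transmit in its first slot and the receivers acknowledge in its second
slot; a link whose acknowledgment is received is completed. -/
def Net.schedStep (G : Net n) (pow : Link n → ℝ) (T : Finset (Link n)) (t : ℕ)
    (σ : SchedState n) (b : Link n → Bool) : SchedState n :=
  fun l =>
    if l ∈ G.confirmed pow (acknowledged (G.received pow (transmitting T σ b))) then some t
    else σ l

/-- The transmission probability in slot-pair `t`: it is `1 / (4 * 2 ^ k)` in phase
`k = 0, 1, 2, …`, which consists of `M * 2 ^ k` slot-pairs. -/
def contentionProb (M t : ℕ) : unitInterval :=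
  ⟨1 / (4 * 2 ^ Nat.log 2 (t / M + 1)), by positivity, by
    have h : (1 : ℝ) ≤ 2 ^ Nat.log 2 (t / M + 1) := one_le_pow₀ (by norm_num)
    rw [div_le_one (by positivity)]
    linarith⟩

/-- The first `t` slot-pairs of the rescheduling of `T`, with `M = ⌈4 * lam * log n⌉`, that is, with
about `lam * log n / q` slot-pairs in the phase with transmission probability `q`. -/
def Net.schedRun (G : Net n) (pow : Link n → ℝ) (lam : ℝ) (T : Finset (Link n)) :
    ℕ → PMF (SchedState n)
  | 0 => PMF.pure (fun _ => none)
  | t + 1 => (G.schedRun pow lam T t).bind fun σ =>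
      (coins (Link n) (contentionProb ⌈4 * lam * Real.log n⌉₊ t)).bind fun b =>
        PMF.pure (G.schedStep pow T t σ b)

/-- The construction of the initial tree, followed by `K` slot-pairs of rescheduling its links with
mean power. -/
def Net.initAndReschedule (G : Net n) (p : unitInterval) (lam₁ lam₂ Γ : ℝ) (K : ℕ) :
    PMF (TreeState n × SchedState n) :=
  (G.init p lam₁).bind fun s =>
    (G.schedRun (G.meanPower Γ) lam₂ (treeLinks s) K).bind fun σ => PMF.pure (s, σ)

end SINR

end

noncomputable section

open scoped Classical

namespace SINR

/-! ### Expectations -/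

/-! The tree. Count rounds from zero, so that round `r` serves the distances in [2^r, 2^(r+1)). As
long as the active nodes are 2^r-separated at its start, a packing argument (`exists_packing_tail`,
which needs α > 2) shows that all but boundedly many nodes contribute little interference. Silencing
those few costs a constant factor, and Markov's inequality handles the rest, so an active node with
an active partner in range becomes inactive with probability at least a constant `a` in each
slot-pair (`exists_success_prob`). After Θ(log n) slot-pairs no pair in range is likely to survive,
which is the separation needed by the next round (`Net.pair_active_prob`). The same constant bounds
degrees: a node can gain a child only while it has an active partner in range, and each such
slot-pair removes the node itself with probability at least `a`; hence it gets `k` children with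
probability at most (1 - a)^k (`Net.children_prob`). Both facts follow from potentials that do not
increase in expectation. `Net.tree_fail_prob` combines them.

The conflicts. Under mean power the relative disturbance of two links l, l' at distance d is (len l
· len l')^(α/2) / d^α, which is symmetric. Fix l, formed in round ρ, and consider longer links whose
round exceeds ρ by between J and 2J. Their endpoints were active at round ρ + J, so they are
2^(ρ+J)-separated, while the geometric mean of the two lengths is at most 2^(ρ+J+1). Packing bounds
their disturbance of l by O(k), where k = O(log n) bounds the degrees. There are only O(log log Δ)
dyadic classes of J, so longer links disturb l by O(Υ log n) in total (`exists_conflict_row_bound`).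
By symmetry, the average disturbance inside every set of tree links is at most some A = O(Υ log n)
(`Net.sum_conflict_le`).

The rescheduling. If pending links are drawn with probability q ≤ 1/(2A), a further use of Markov's
inequality shows that the expected number of pending links shrinks by the factor 1 - q/2
(`Net.coinMean_pending_le`). The phase with q of order 1/A has Θ(log n / q) slot-pairs, which makes
this expectation polynomially small (`Net.mean_pending_le`). All phases up to it have O(A log n)
slot-pairs. Feasibility of the new slots is automatic, since the completed links succeeded while a
larger set was transmitting. -/

/-- The expectation of `f` when independent coins are tossed, each `true` with probability `p`. -/
def coinMean {ι : Type} [Fintype ι] (p : ℝ) (f : (ι → Bool) → ℝ) : ℝ :=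
  ∑ b, (∏ i, cond (b i) p (1 - p)) * f b

/-- The expectation of a nonnegative function under a discrete distribution. -/
def mean {Ω : Type*} (μ : PMF Ω) (f : Ω → ENNReal) : ENNReal := ∑' x, μ x * f x

section coinMean

variable {ι : Type} [Fintype ι] {p : ℝ}

lemma coin_weight_nonneg (h₀ : 0 ≤ p) (h₁ : p ≤ 1) (b : ι → Bool) :
    0 ≤ ∏ i, cond (b i) p (1 - p) :=
  Finset.prod_nonneg fun i _ => by cases b i <;> simp [h₀, h₁]

lemma coinMean_mono (h₀ : 0 ≤ p) (h₁ : p ≤ 1) {f g : (ι → Bool) → ℝ} (h : ∀ b, f b ≤ g b) :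
    coinMean p f ≤ coinMean p g :=
  Finset.sum_le_sum fun b _ => mul_le_mul_of_nonneg_left (h b) (coin_weight_nonneg h₀ h₁ b)

lemma coinMean_nonneg (h₀ : 0 ≤ p) (h₁ : p ≤ 1) {f : (ι → Bool) → ℝ} (h : ∀ b, 0 ≤ f b) :
    0 ≤ coinMean p f :=
  Finset.sum_nonneg fun b _ => mul_nonneg (coin_weight_nonneg h₀ h₁ b) (h b)

lemma coinMean_sub (f g : (ι → Bool) → ℝ) :
    coinMean p (fun b => f b - g b) = coinMean p f - coinMean p g := by
  simp [coinMean, mul_sub, Finset.sum_sub_distrib]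

lemma coinMean_const_mul (c : ℝ) (f : (ι → Bool) → ℝ) :
    coinMean p (fun b => c * f b) = c * coinMean p f := by
  rw [coinMean, coinMean, Finset.mul_sum]
  exact Finset.sum_congr rfl fun b _ => by ring

lemma coinMean_mul_const (c : ℝ) (f : (ι → Bool) → ℝ) :
    coinMean p (fun b => f b * c) = coinMean p f * c := by
  simp_rw [mul_comm _ c]
  exact coinMean_const_mul c f

lemma coinMean_sum {κ : Type*} (s : Finset κ) (f : κ → (ι → Bool) → ℝ) :
    coinMean p (fun b => ∑ k ∈ s, f k b) = ∑ k ∈ s, coinMean p (f k) := by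
  simp only [coinMean, Finset.mul_sum]
  exact Finset.sum_comm

/-- Independence of the coins: expanding the product of two-term sums yields the sum over all
outcomes. -/
lemma coinMean_prod (χ : ι → Bool → ℝ) :
    coinMean p (fun b => ∏ i, χ i (b i)) = ∏ i, (p * χ i true + (1 - p) * χ i false) := by
  have key := Finset.prod_univ_sum (fun _ : ι => (Finset.univ : Finset Bool))
    (fun i b => cond b p (1 - p) * χ i b)
  rw [Fintype.piFinset_univ] at key
  simp only [Fintype.sum_bool, cond_true, cond_false] at key
  rw [key, coinMean]
  exact Finset.sum_congr rfl fun b _ => by rw [← Finset.prod_mul_distrib]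

lemma coinMean_const (c : ℝ) : coinMean (ι := ι) p (fun _ => c) = c := by
  have h := coinMean_prod (ι := ι) (p := p) (fun _ _ => 1)
  simp only [Finset.prod_const_one, mul_one, add_sub_cancel] at h
  simpa [h] using coinMean_const_mul (p := p) c (fun _ : ι → Bool => (1 : ℝ))

/-- The probability that the coins in `A` show `true` and those in `B` show `false`. -/
lemma coinMean_on_off [DecidableEq ι] (A B : Finset ι) (hAB : Disjoint A B) :
    coinMean p (fun b => if (∀ i ∈ A, b i = true) ∧ ∀ i ∈ B, b i = false then 1 else 0) =
      p ^ A.card * (1 - p) ^ B.card := by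
  have h := coinMean_prod (p := p) (fun (i : ι) (c : Bool) =>
    (if i ∈ A then cond c (1 : ℝ) 0 else 1) * (if i ∈ B then cond c (0 : ℝ) 1 else 1))
  have h1 : ∀ b : ι → Bool, (∏ i, (if i ∈ A then cond (b i) (1 : ℝ) 0 else 1) *
      (if i ∈ B then cond (b i) (0 : ℝ) 1 else 1)) =
      if (∀ i ∈ A, b i = true) ∧ ∀ i ∈ B, b i = false then 1 else 0 := by
    intro b
    split_ifs with hb
    · refine Finset.prod_eq_one fun i _ => ?_
      by_cases hA : i ∈ A
      · have := Finset.disjoint_left.1 hAB hA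
        simp [hA, this, hb.1 i hA]
      · by_cases hB : i ∈ B
        · simp [hA, hB, hb.2 i hB]
        · simp [hA, hB]
    · rw [not_and_or] at hb
      push Not at hb
      rcases hb with ⟨i, hi, hbi⟩ | ⟨i, hi, hbi⟩
      · exact Finset.prod_eq_zero (Finset.mem_univ i) (by simp [hi, hbi])
      · exact Finset.prod_eq_zero (Finset.mem_univ i) (by simp [hi, hbi])
  simp only [h1] at h
  rw [h]
  have h2 : ∀ i, (p * ((if i ∈ A then cond true (1 : ℝ) 0 else 1) *
      (if i ∈ B then cond true (0 : ℝ) 1 else 1)) +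
      (1 - p) * ((if i ∈ A then cond false (1 : ℝ) 0 else 1) *
      (if i ∈ B then cond false (0 : ℝ) 1 else 1))) =
      (if i ∈ A then p else 1) * (if i ∈ B then 1 - p else 1) := by
    intro i
    by_cases hA : i ∈ A
    · have := Finset.disjoint_left.1 hAB hA
      simp [hA, this]
    · by_cases hB : i ∈ B <;> simp [hA, hB]
  rw [Finset.prod_congr rfl fun i _ => h2 i, Finset.prod_mul_distrib]
  simp

/-- With a not too small probability, the coin `i₀` shows `true`, those in `B` show `false`, and the
other coins that show `true` have a total weight less than `1`. -/
lemma le_coinMean_weight_lt_one [DecidableEq ι] (h₀ : 0 ≤ p) (h₁ : p ≤ 1) (i₀ : ι) (B : Finset ι) (hB : i₀ ∉ B)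
    (w : ι → ℝ) (hw : ∀ i, 0 ≤ w i) :
    p * (1 - p) ^ B.card * (1 - p * ∑ i ∈ (insert i₀ B)ᶜ, w i) ≤
      coinMean p (fun b => if b i₀ = true ∧ (∀ i ∈ B, b i = false) ∧
        ∑ i with i ≠ i₀ ∧ b i = true, w i < 1 then 1 else 0) := by
  set g : Finset ι → (ι → Bool) → ℝ := fun A b =>
    if (∀ i ∈ A, b i = true) ∧ ∀ i ∈ B, b i = false then 1 else 0 with hg
  -- Markov's inequality in pointwise form: once `i₀` is on and `B` is off, the indicator of small
  -- weight is at least one minus the weight; otherwise both sides vanish. The left side involves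
  -- only events with at most two coins on, so its mean is explicit.
  have hle : ∀ b, g {i₀} b - ∑ i ∈ (insert i₀ B)ᶜ, w i * g {i₀, i} b ≤
      if b i₀ = true ∧ (∀ i ∈ B, b i = false) ∧
        ∑ i with i ≠ i₀ ∧ b i = true, w i < 1 then 1 else 0 := by
    intro b
    by_cases h : b i₀ = true ∧ ∀ i ∈ B, b i = false
    · have e1 : g {i₀} b = 1 := by simp [hg, h.1]; exact h.2
      have e2 : ∑ i ∈ (insert i₀ B)ᶜ, w i * g {i₀, i} b =
          ∑ i with i ≠ i₀ ∧ b i = true, w i := by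
        have : ∀ i, w i * g {i₀, i} b = if b i = true then w i else 0 := by
          intro i
          have : g {i₀, i} b = if b i = true then 1 else 0 := by
            simp only [hg]
            congr 1
            simp only [Finset.mem_insert, Finset.mem_singleton, forall_eq_or_imp, forall_eq,
              eq_iff_iff]
            tauto
          rw [this]; split_ifs <;> simp
        rw [Finset.sum_congr rfl fun i _ => this i, ← Finset.sum_filter]
        refine Finset.sum_congr ?_ fun _ _ => rfl
        ext i
        simp only [Finset.mem_filter, Finset.mem_compl, Finset.mem_insert, Finset.mem_univ,
          true_and, not_or]
        constructor
        · rintro ⟨⟨h1, h2⟩, h3⟩; exact ⟨h1, h3⟩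
        · rintro ⟨h1, h3⟩
          refine ⟨⟨h1, fun h4 => ?_⟩, h3⟩
          simp [h.2 i h4] at h3
      rw [e1, e2]
      split_ifs with h5
      · linarith [Finset.sum_nonneg (s := {i | i ≠ i₀ ∧ b i = true}) fun i _ => hw i]
      · have : 1 ≤ ∑ i with i ≠ i₀ ∧ b i = true, w i := by
          by_contra h6
          exact h5 ⟨h.1, h.2, not_le.1 h6⟩
        linarith
    · have e1 : ∀ A, i₀ ∈ A → g A b = 0 := by
        intro A hA
        simp only [hg]
        rw [if_neg]
        rintro ⟨h1, h2⟩
        exact h ⟨h1 _ hA, h2⟩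
      rw [e1 _ (by simp), Finset.sum_eq_zero fun i _ => by rw [e1 _ (by simp), mul_zero]]
      split_ifs <;> norm_num
  refine le_trans (le_of_eq ?_) (coinMean_mono h₀ h₁ hle)
  rw [coinMean_sub, coinMean_sum]
  have e1 : coinMean p (g {i₀}) = p * (1 - p) ^ B.card := by
    rw [hg, coinMean_on_off _ _ (by simpa using hB)]; simp
  have e2 : ∀ i ∈ (insert i₀ B)ᶜ, coinMean p (fun b => w i * g {i₀, i} b) =
      p * (1 - p) ^ B.card * (p * w i) := by
    intro i hi
    simp only [Finset.mem_compl, Finset.mem_insert, not_or] at hi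
    rw [coinMean_const_mul, hg, coinMean_on_off, Finset.card_pair (Ne.symm hi.1)]
    · ring
    · simp [hB, hi.2]
  rw [e1, Finset.sum_congr rfl e2, ← Finset.mul_sum, ← Finset.mul_sum]
  ring

end coinMean

/-! ### Discrete distributions and Markov chains -/

lemma coins_apply {ι : Type} [Fintype ι] (p : unitInterval) (b : ι → Bool) :
    coins ι p b = ENNReal.ofReal (∏ i, cond (b i) (p : ℝ) (1 - p)) := by
  rw [coins, PMF.ofFintype_apply, ENNReal.ofReal_prod_of_nonneg]
  · exact Finset.prod_congr rfl fun i _ => by cases b i <;> rfl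
  · intro i _
    cases b i
    · simpa using p.2.2
    · simpa using p.2.1

section mean

variable {Ω Ω' : Type*}

lemma mean_pure (x : Ω) (f : Ω → ENNReal) : mean (PMF.pure x) f = f x := by
  rw [mean, tsum_eq_single x]
  · simp
  · intro y hy; simp [hy]

lemma mean_bind (μ : PMF Ω) (κ : Ω → PMF Ω') (f : Ω' → ENNReal) :
    mean (μ.bind κ) f = mean μ fun x => mean (κ x) f := by
  simp only [mean, PMF.bind_apply, ← ENNReal.tsum_mul_right, ← ENNReal.tsum_mul_left]
  rw [ENNReal.tsum_comm]
  exact tsum_congr fun x => tsum_congr fun y => by ring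

lemma mean_mono_of_support (μ : PMF Ω) {f g : Ω → ENNReal} (h : ∀ x ∈ μ.support, f x ≤ g x) :
    mean μ f ≤ mean μ g := by
  refine ENNReal.tsum_le_tsum fun x => ?_
  by_cases hx : μ x = 0
  · simp [hx]
  · exact mul_le_mul_right (h x ((PMF.mem_support_iff _ _).2 hx)) _

lemma mean_add (μ : PMF Ω) (f g : Ω → ENNReal) :
    mean μ (fun x => f x + g x) = mean μ f + mean μ g := by
  simp only [mean, mul_add]
  exact ENNReal.tsum_add

lemma mean_sum {κ : Type*} (μ : PMF Ω) (s : Finset κ) (f : κ → Ω → ENNReal) :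
    mean μ (fun x => ∑ k ∈ s, f k x) = ∑ k ∈ s, mean μ (f k) := by
  induction s using Finset.induction_on with
  | empty => simp [mean]
  | insert a s ha ih => simp only [Finset.sum_insert ha, mean_add, ih]

lemma mean_const (μ : PMF Ω) (c : ENNReal) : mean μ (fun _ => c) = c := by
  rw [mean, ENNReal.tsum_mul_right, μ.tsum_coe, one_mul]

lemma toOuterMeasure_eq_mean (μ : PMF Ω) (A : Set Ω) :
    μ.toOuterMeasure A = mean μ (A.indicator fun _ => 1) := by
  rw [PMF.toOuterMeasure_apply, mean]
  refine tsum_congr fun x => ?_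
  by_cases hx : x ∈ A <;> simp [hx]

lemma mean_coins {ι : Type} [Fintype ι] (p : unitInterval) {f : (ι → Bool) → ℝ}
    (hf : ∀ b, 0 ≤ f b) :
    mean (coins ι p) (fun b => ENNReal.ofReal (f b)) = ENNReal.ofReal (coinMean p f) := by
  have hw := coin_weight_nonneg (ι := ι) p.2.1 p.2.2
  rw [mean, tsum_fintype, coinMean,
    ENNReal.ofReal_sum_of_nonneg fun b _ => mul_nonneg (hw b) (hf b)]
  exact Finset.sum_congr rfl fun b _ => by rw [coins_apply, ENNReal.ofReal_mul (hw b)]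

variable {μ : ℕ → PMF Ω} {κ : ℕ → Ω → PMF Ω} {x₀ : Ω} {I : ℕ → Ω → Prop}

lemma chain_support (h0 : μ 0 = PMF.pure x₀) (hs : ∀ t, μ (t + 1) = (μ t).bind (κ t))
    (hI0 : I 0 x₀) (hI : ∀ t x, I t x → ∀ y ∈ (κ t x).support, I (t + 1) y) (t : ℕ) :
    ∀ x ∈ (μ t).support, I t x := by
  induction t with
  | zero => intro x hx; rw [h0, PMF.mem_support_pure_iff] at hx; rwa [hx]
  | succ t ih =>
    intro y hy
    rw [hs, PMF.mem_support_bind_iff] at hy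
    obtain ⟨x, hx, hy⟩ := hy
    exact hI t x (ih x hx) y hy

/-- A potential that never increases in expectation stays below its initial value. -/
lemma chain_mean_le (h0 : μ 0 = PMF.pure x₀) (hs : ∀ t, μ (t + 1) = (μ t).bind (κ t))
    (hI0 : I 0 x₀) (hI : ∀ t x, I t x → ∀ y ∈ (κ t x).support, I (t + 1) y)
    (Φ : ℕ → Ω → ENNReal) (T : ℕ)
    (hΦ : ∀ t < T, ∀ x, I t x → mean (κ t x) (Φ (t + 1)) ≤ Φ t x) :
    mean (μ T) (Φ T) ≤ Φ 0 x₀ := by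
  induction T with
  | zero => rw [h0, mean_pure]
  | succ T ih =>
    rw [hs, mean_bind]
    refine le_trans (mean_mono_of_support _ fun x hx => ?_) (ih fun t ht => hΦ t (by omega))
    exact hΦ T (by omega) x (chain_support h0 hs hI0 hI T x hx)

end mean

/-! ### Packing in the plane -/

/-- The square with side length `δ / 2` that contains `y`, in the grid with origin `x`. -/
def gridCell (δ : ℝ) (x y : EuclideanSpace ℝ (Fin 2)) : Fin 2 → ℤ :=
  fun i => ⌊(y i - x i) / (δ / 2)⌋

/-- The diagonal δ/√2 of a cell is shorter than δ. Hence δ-separated points lie in distinct cells,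
and sums over points become sums over ℤ². -/
lemma dist_lt_of_gridCell_eq {δ : ℝ} (hδ : 0 < δ) {x y z : EuclideanSpace ℝ (Fin 2)}
    (h : gridCell δ x y = gridCell δ x z) : dist y z < δ := by
  have hi : ∀ i, dist (y i) (z i) ^ 2 ≤ (δ / 2) ^ 2 := by
    intro i
    have h1 : ⌊(y i - x i) / (δ / 2)⌋ = ⌊(z i - x i) / (δ / 2)⌋ := congrFun h i
    have h2 := Int.abs_sub_lt_one_of_floor_eq_floor h1
    rw [← sub_div, abs_div, abs_of_pos (half_pos hδ), div_lt_one (half_pos hδ)] at h2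
    rw [Real.dist_eq]
    refine pow_le_pow_left₀ (abs_nonneg _) (le_of_lt ?_) 2
    rwa [sub_sub_sub_cancel_right] at h2
  rw [EuclideanSpace.dist_eq, Real.sqrt_lt' hδ, Fin.sum_univ_two]
  nlinarith [hi 0, hi 1]

lemma norm_gridCell_le {δ : ℝ} (hδ : 0 < δ) (x y : EuclideanSpace ℝ (Fin 2)) :
    ‖gridCell δ x y‖ ≤ 2 * dist x y / δ + 1 := by
  have hpos : 0 ≤ 2 * dist x y / δ + 1 := by positivity
  rw [pi_norm_le_iff_of_nonneg hpos]
  intro i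
  have h1 : |y i - x i| ≤ dist x y := by
    have := PiLp.norm_apply_le (y - x) i
    rwa [← dist_eq_norm, dist_comm, PiLp.sub_apply, Real.norm_eq_abs] at this
  have h2 : |(y i - x i) / (δ / 2)| ≤ 2 * dist x y / δ := by
    rw [abs_div, abs_of_pos (half_pos hδ), div_le_div_iff₀ (half_pos hδ) hδ]
    nlinarith
  rw [abs_le] at h2
  rw [gridCell, Int.norm_eq_abs, abs_le]
  constructor
  · linarith [Int.lt_floor_add_one ((y i - x i) / (δ / 2))]
  · linarith [Int.floor_le ((y i - x i) / (δ / 2))]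

/-- This convergence over the two-dimensional lattice is what α > 2 is needed for. The maximum with
1 changes only the term at the origin. -/
lemma summable_max_one_norm_rpow {α : ℝ} (hα : 2 < α) :
    Summable fun c : Fin 2 → ℤ => (max 1 ‖c‖) ^ (-α) := by
  refine (summable_congr_cofinite ?_).1 (EisensteinSeries.summable_one_div_norm_rpow hα)
  refine Set.Finite.subset (Set.finite_singleton 0) fun c hc => ?_
  by_contra h0
  refine hc ?_
  have hc0 : c ≠ 0 := h0
  obtain ⟨i, hi⟩ := Function.ne_iff.1 hc0
  have h1 : (1 : ℝ) ≤ ‖c i‖ := by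
    rw [Int.norm_eq_abs]
    exact_mod_cast Int.one_le_abs hi
  change ‖c‖ ^ (-α) = max 1 ‖c‖ ^ (-α)
  rw [max_eq_right (h1.trans (norm_le_pi_norm c i))]

/-- For separated points, all but a bounded number of them contribute little to the sum of the
decaying weights. -/
lemma exists_packing_tail {α ε : ℝ} (hα : 2 < α) (hε : 0 < ε) :
    ∃ k : ℕ, ∀ {ι : Type} [DecidableEq ι] (V : Finset ι) (pos : ι → EuclideanSpace ℝ (Fin 2)) (δ : ℝ)
      (x : EuclideanSpace ℝ (Fin 2)), 0 < δ →
      (∀ a ∈ V, ∀ b ∈ V, a ≠ b → δ ≤ dist (pos a) (pos b)) →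
      ∃ B ⊆ V, B.card ≤ k ∧ ∑ y ∈ V \ B, (max 1 (dist x (pos y) / δ)) ^ (-α) ≤ ε := by
  have h3 : (0 : ℝ) < 3 ^ α := by positivity
  -- Finitely many cells `F` carry all but ε / 3^α of the lattice sum. The points in these cells are
  -- the exceptional set, so its size is bounded independently of the points, the scale and the
  -- centre.
  obtain ⟨F, hF⟩ := (summable_max_one_norm_rpow hα).vanishing
    (Iio_mem_nhds (show (0 : ℝ) < ε / 3 ^ α by positivity))
  refine ⟨F.card, fun {ι} _ V pos δ x hδ hsep => ?_⟩
  have hinj : Set.InjOn (fun a => gridCell δ x (pos a)) V := by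
    intro a ha b hb hab
    by_contra hne
    exact absurd (hsep a ha b hb hne) (not_le.2 (dist_lt_of_gridCell_eq hδ hab))
  refine ⟨{a ∈ V | gridCell δ x (pos a) ∈ F}, Finset.filter_subset _ _, ?_, ?_⟩
  · refine Finset.card_le_card_of_injOn _ (fun a ha => (Finset.mem_filter.1 ha).2)
      (hinj.mono fun a ha => (Finset.mem_filter.1 ha).1)
  · rw [show V \ {a ∈ V | gridCell δ x (pos a) ∈ F} = {a ∈ V | gridCell δ x (pos a) ∉ F} by grind]
    have h1 : ∀ a ∈ V.filter (fun a => gridCell δ x (pos a) ∉ F),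
        (max 1 (dist x (pos a) / δ)) ^ (-α) ≤
          3 ^ α * (max 1 ‖gridCell δ x (pos a)‖) ^ (-α) := by
      intro a _
      -- The source of the factor 3: a cell index has norm at most 2D + 1 ≤ 3 max(1, D), where D is
      -- the distance in units of δ.
      have h4 : max 1 ‖gridCell δ x (pos a)‖ ≤ 3 * max 1 (dist x (pos a) / δ) := by
        have := norm_gridCell_le hδ x (pos a)
        rw [mul_div_assoc] at this
        have e1 := le_max_left 1 (dist x (pos a) / δ)
        have e2 := le_max_right 1 (dist x (pos a) / δ)
        exact max_le (by linarith) (by linarith)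
      have h5 : (0 : ℝ) < max 1 ‖gridCell δ x (pos a)‖ := by positivity
      have h6 : (0 : ℝ) < max 1 (dist x (pos a) / δ) := by positivity
      have h7 := Real.rpow_le_rpow h5.le h4 (show 0 ≤ α by linarith)
      rw [Real.mul_rpow (by norm_num) h6.le] at h7
      rw [Real.rpow_neg h5.le, Real.rpow_neg h6.le, ← div_eq_mul_inv,
        le_div_iff₀ (by positivity), inv_mul_le_iff₀ (by positivity)]
      linarith
    refine (Finset.sum_le_sum h1).trans ?_
    rw [← Finset.mul_sum]
    have h8 := hF ((V.filter (fun a => gridCell δ x (pos a) ∉ F)).image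
      (fun a => gridCell δ x (pos a))) (by
        rw [Finset.disjoint_left]
        intro c hc
        obtain ⟨a, ha, rfl⟩ := Finset.mem_image.1 hc
        exact (Finset.mem_filter.1 ha).2)
    rw [Finset.sum_image (hinj.mono fun a ha => (Finset.mem_filter.1 ha).1), Set.mem_Iio,
      lt_div_iff₀ h3] at h8
    linarith

/-- Each of the `k` exceptional points contributes at most 1, and the others contribute at most ε =
1 together. -/
lemma exists_packing_sum {α : ℝ} (hα : 2 < α) :
    ∃ C : ℝ, 0 < C ∧ ∀ {ι : Type} (V : Finset ι) (pos : ι → EuclideanSpace ℝ (Fin 2)) (δ : ℝ)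
      (x : EuclideanSpace ℝ (Fin 2)), 0 < δ →
      (∀ a ∈ V, ∀ b ∈ V, a ≠ b → δ ≤ dist (pos a) (pos b)) →
      ∑ y ∈ V, (max 1 (dist x (pos y) / δ)) ^ (-α) ≤ C := by
  obtain ⟨k, hk⟩ := exists_packing_tail hα one_pos
  refine ⟨1 + k, by positivity, fun {ι} V pos δ x hδ hsep => ?_⟩
  obtain ⟨B, hBV, hBk, hB⟩ := hk V pos δ x hδ hsep
  rw [← Finset.sum_sdiff hBV]
  refine add_le_add hB ?_
  have h1 : ∑ y ∈ B, (max 1 (dist x (pos y) / δ)) ^ (-α) ≤ ∑ y ∈ B, (1 : ℝ) :=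
    Finset.sum_le_sum fun y _ =>
      Real.rpow_le_one_of_one_le_of_nonpos (le_max_left _ _) (by linarith)
  refine h1.trans ?_
  simpa using hBk

variable {n : ℕ}

/-! ### Feasibility -/

lemma nodePower_eq {pow : Link n → ℝ} {L : Finset (Link n)}
    (hinj : Set.InjOn Prod.fst (L : Set (Link n))) {l : Link n} (hl : l ∈ L) :
    nodePower pow L l.1 = pow l := by
  rw [nodePower, Finset.sum_eq_single l]
  · intro l' hl' hne
    rw [Finset.mem_filter] at hl'
    exact absurd (hinj hl'.1 hl hl'.2) hne
  · intro h; exact absurd (Finset.mem_filter.2 ⟨hl, rfl⟩ : l ∈ L.filter fun l' => l'.1 = l.1) h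

/-- Links that succeed while a superset of their senders transmits form a feasible set. -/
lemma Net.feasible_of_receives (G : Net n) (hN : 0 < G.N) {pow : Link n → ℝ}
    {L : Finset (Link n)} {S : Finset (Fin n)} {P : Fin n → ℝ}
    (hinj : Set.InjOn Prod.fst (L : Set (Link n))) (hpow : ∀ l ∈ L, P l.1 = pow l)
    (hP : ∀ w, 0 ≤ P w) (h : ∀ l ∈ L, G.Receives S P l.1 l.2) : G.Feasible pow L := by
  refine ⟨hinj, fun l hl => ?_⟩
  have hsub : senders L ⊆ S := by
    intro w hw
    obtain ⟨l', hl', rfl⟩ := Finset.mem_image.1 hw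
    exact (h l' hl').1
  have hnode : ∀ w ∈ senders L, nodePower pow L w = P w := by
    intro w hw
    obtain ⟨l', hl', rfl⟩ := Finset.mem_image.1 hw
    rw [nodePower_eq hinj hl', hpow l' hl']
  have hmem : l.1 ∈ senders L := Finset.mem_image_of_mem _ hl
  obtain ⟨-, h2, h3⟩ := h l hl
  refine ⟨hmem, fun h4 => h2 (hsub h4), h3.trans ?_⟩
  have hterm : ∀ w, 0 ≤ P w / G.d w l.2 ^ G.α := fun w =>
    div_nonneg (hP w) (Real.rpow_nonneg dist_nonneg _)
  have hsum : ∑ w ∈ (senders L).erase l.1, nodePower pow L w / G.d w l.2 ^ G.α =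
      ∑ w ∈ (senders L).erase l.1, P w / G.d w l.2 ^ G.α :=
    Finset.sum_congr rfl fun w hw => by rw [hnode w (Finset.mem_of_mem_erase hw)]
  rw [hnode _ hmem, hsum]
  refine div_le_div_of_nonneg_left (hterm _)
    (add_pos_of_pos_of_nonneg hN (Finset.sum_nonneg fun w _ => hterm w)) ?_
  refine add_le_add_right ?_ _
  exact Finset.sum_le_sum_of_subset_of_nonneg (Finset.erase_subset_erase _ hsub)
    fun w _ _ => hterm w

/-! ### The construction of the tree -/

lemma mem_of_pick_eq_some {A : Finset (Fin n)} {x : Fin n} (h : pick A = some x) : x ∈ A := by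
  unfold pick at h
  split_ifs at h with hA
  rw [← Option.some.inj h]
  exact A.min'_mem hA

lemma exists_pick_eq_some {A : Finset (Fin n)} (h : A.Nonempty) : ∃ x, pick A = some x :=
  ⟨_, dif_pos h⟩

lemma pick_eq_some_of_forall_eq {A : Finset (Fin n)} {x : Fin n} (hx : x ∈ A)
    (h : ∀ y ∈ A, y = x) : pick A = some x := by
  obtain ⟨y, hy⟩ := exists_pick_eq_some ⟨x, hx⟩
  rw [hy, h y (mem_of_pick_eq_some hy)]

lemma Net.heard_eq_some {G : Net n} {r : ℕ} {s : TreeState n} {b : Fin n → Bool} {u v : Fin n}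
    (h : G.heard r s b v = some u) :
    s v = none ∧ b v = false ∧
      G.Receives (broadcasters s b) (fun _ => G.roundPower r) u v ∧
      (2 : ℝ) ^ (r - 1) ≤ G.d u v ∧ G.d u v < (2 : ℝ) ^ r := by
  unfold Net.heard at h
  split_ifs at h with hv
  have := mem_of_pick_eq_some h
  simp only [Finset.mem_filter, Finset.mem_univ, true_and] at this
  exact ⟨hv.1, hv.2, this⟩

lemma Net.treeStep_of_ne_none (G : Net n) {r t : ℕ} {s : TreeState n} {b a : Fin n → Bool}
    {u : Fin n} (h : s u ≠ none) : G.treeStep r t s b a u = s u := by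
  simp [Net.treeStep, broadcasters, h]

lemma Net.treeStep_of_listener (G : Net n) {r t : ℕ} {s : TreeState n} {b a : Fin n → Bool}
    {u : Fin n} (h : b u = false) : G.treeStep r t s b a u = s u := by
  simp [Net.treeStep, broadcasters, h]

lemma Net.treeStep_eq_some {G : Net n} {r t τ : ℕ} {s : TreeState n} {b a : Fin n → Bool}
    {u v : Fin n} (h : G.treeStep r t s b a u = some (τ, v)) :
    s u = some (τ, v) ∨ (s u = none ∧ b u = true ∧ τ = t ∧ G.heard r s b v = some u ∧
      G.Receives (G.ackers r s b a) (fun _ => G.roundPower r) v u) := by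
  unfold Net.treeStep at h
  split_ifs at h with hu
  · right
    rw [Option.map_eq_some_iff] at h
    obtain ⟨v', hv', heq⟩ := h
    obtain ⟨rfl, rfl⟩ := Prod.mk.inj heq
    have := mem_of_pick_eq_some hv'
    simp only [Finset.mem_filter, Finset.mem_univ, true_and, broadcasters] at this hu
    exact ⟨hu.1, hu.2, rfl, this⟩
  · exact Or.inl h

/-- What holds for every state that the construction can reach in `t` slot-pairs. -/
structure TreeInv (G : Net n) (m t : ℕ) (s : TreeState n) : Prop where
  stamp_lt : ∀ u τ v, s u = some (τ, v) → τ < t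
  -- A parent is still active when it is chosen. This makes the links acyclic and gives the order
  -- required of the schedule.
  later : ∀ u τ v, s u = some (τ, v) → ∀ τ' v', s v = some (τ', v') → τ < τ'
  len : ∀ u τ v, s u = some (τ, v) →
    (2 : ℝ) ^ (τ / m) ≤ G.d u v ∧ G.d u v < (2 : ℝ) ^ (τ / m + 1)
  active : ∃ u, s u = none
  inj : ∀ u u' τ v, s u = some (τ, v) → s u' = some (τ, v) → u = u'
  -- The transmitting set `S` may be larger than the set of successful senders;
  -- `Net.feasible_of_receives` needs no more.
  up : ∀ τ, ∃ S, ∀ u v, s u = some (τ, v) →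
    G.Receives S (fun _ => G.roundPower (τ / m + 1)) u v
  down : ∀ τ, ∃ S, ∀ u v, s u = some (τ, v) →
    G.Receives S (fun _ => G.roundPower (τ / m + 1)) v u

lemma treeInv_zero (G : Net n) (hn : 0 < n) (m : ℕ) : TreeInv G m 0 (fun _ => none) where
  stamp_lt := by simp
  later := by simp
  len := by simp
  active := ⟨⟨0, hn⟩, rfl⟩
  inj := by simp
  up := by simp
  down := by simp

/-- The new parent has heard a message, so it was a listener and its own state does not change in
this slot-pair. This preserves `later` and an active node; `inj` holds because a listener
acknowledges a single broadcaster. -/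
lemma TreeInv.step {G : Net n} {m t : ℕ} {s : TreeState n} (h : TreeInv G m t s)
    (b a : Fin n → Bool) : TreeInv G m (t + 1) (G.treeStep (t / m + 1) t s b a) where
  stamp_lt u τ v hu := by
    rcases G.treeStep_eq_some hu with hu | ⟨_, _, rfl, _⟩
    · exact (h.stamp_lt u τ v hu).trans (Nat.lt_succ_self t)
    · exact Nat.lt_succ_self _
  later u τ v hu τ' v' hv := by
    rcases G.treeStep_eq_some hu with h1 | ⟨_, _, _, hh, _⟩
    · rcases G.treeStep_eq_some hv with h2 | ⟨_, _, hτ', _⟩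
      · exact h.later u τ v h1 τ' v' h2
      · rw [hτ']
        exact h.stamp_lt u τ v h1
    · obtain ⟨h1, h2, -⟩ := Net.heard_eq_some hh
      rw [G.treeStep_of_listener h2, h1] at hv
      exact absurd hv (by simp)
  len u τ v hu := by
    rcases G.treeStep_eq_some hu with hu | ⟨_, _, rfl, hh, _⟩
    · exact h.len u τ v hu
    · exact (Net.heard_eq_some hh).2.2.2
  active := by
    by_contra hcon
    push Not at hcon
    obtain ⟨u, hu⟩ := h.active
    obtain ⟨⟨τ, v⟩, hv⟩ := Option.ne_none_iff_exists'.1 (hcon u)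
    rcases G.treeStep_eq_some hv with hv | ⟨_, _, rfl, hh, _⟩
    · simp [hu] at hv
    · obtain ⟨h1, h2, -⟩ := Net.heard_eq_some hh
      exact hcon v (by rw [G.treeStep_of_listener h2, h1])
  inj u u' τ v hu hu' := by
    rcases G.treeStep_eq_some hu with h1 | ⟨_, _, hτ, hh, _⟩
    · rcases G.treeStep_eq_some hu' with h2 | ⟨_, _, hτ, _, _⟩
      · exact h.inj u u' τ v h1 h2
      · exact absurd (h.stamp_lt u _ v h1) (by simp [hτ])
    · rcases G.treeStep_eq_some hu' with h2 | ⟨_, _, _, hh', _⟩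
      · exact absurd (h.stamp_lt u' _ v h2) (by simp [hτ])
      · rw [hh] at hh'; exact Option.some.inj hh'
  up τ := by
    by_cases hτ : τ = t
    · subst hτ
      refine ⟨broadcasters s b, fun u v hu => ?_⟩
      rcases G.treeStep_eq_some hu with hu | ⟨_, _, _, hh, _⟩
      · exact absurd (h.stamp_lt u _ v hu) (lt_irrefl _)
      · exact (Net.heard_eq_some hh).2.2.1
    · obtain ⟨S, hS⟩ := h.up τ
      refine ⟨S, fun u v hu => ?_⟩
      rcases G.treeStep_eq_some hu with hu | ⟨_, _, h1, _⟩
      · exact hS u v hu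
      · exact absurd h1 hτ
  down τ := by
    by_cases hτ : τ = t
    · subst hτ
      refine ⟨G.ackers (τ / m + 1) s b a, fun u v hu => ?_⟩
      rcases G.treeStep_eq_some hu with hu | ⟨_, _, _, _, hr⟩
      · exact absurd (h.stamp_lt u _ v hu) (lt_irrefl _)
      · exact hr
    · obtain ⟨S, hS⟩ := h.down τ
      refine ⟨S, fun u v hu => ?_⟩
      rcases G.treeStep_eq_some hu with hu | ⟨_, _, h1, _⟩
      · exact hS u v hu
      · exact absurd h1 hτ

lemma mem_upLinks {s : TreeState n} {u v : Fin n} :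
    (u, v) ∈ upLinks s ↔ ∃ t, s u = some (t, v) := by
  simp [upLinks]

lemma stamp_eq {s : TreeState n} {u v w : Fin n} {t : ℕ} (h : s u = some (t, v)) :
    stamp s (u, w) = t := by
  simp [stamp, h]

lemma roundPower_pos (G : Net n) (hβ : 0 < G.β) (hN : 0 < G.N) (r : ℕ) : 0 < G.roundPower r := by
  unfold Net.roundPower; positivity

/-- A reachable state in which only one node is active describes a bi-tree. -/
lemma TreeInv.isBiTree {G : Net n} {m t : ℕ} {s : TreeState n} (h : TreeInv G m t s)
    (hβ : 0 < G.β) (hN : 0 < G.N) (huniq : ∀ u v, s u = none → s v = none → u = v) :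
    IsBiTree G (upLinks s) (stamp s) (fun t _ => G.roundPower (t / m + 1)) where
  tree := by
    obtain ⟨root, hroot⟩ := h.active
    refine ⟨root, fun u hu => ?_, fun v hv => ?_, ?_⟩
    · obtain ⟨⟨τ, v⟩, hv⟩ := Option.ne_none_iff_exists'.1 fun h0 => hu (huniq u root h0 hroot)
      refine ⟨v, mem_upLinks.2 ⟨τ, hv⟩, fun v' hv' => ?_⟩
      obtain ⟨τ', hv'⟩ := mem_upLinks.1 hv'
      rw [hv] at hv'
      exact ((Prod.mk.inj (Option.some.inj hv')).2).symm
    · obtain ⟨τ, hτ⟩ := mem_upLinks.1 hv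
      simp [hroot] at hτ
    -- Stamps increase strictly along a path and stay below `t`. The induction variable bounds the
    -- time left.
    · have key : ∀ k u, (∀ τ v, s u = some (τ, v) → t ≤ τ + k) →
          Relation.ReflTransGen (fun a b => (a, b) ∈ upLinks s) u root := by
        intro k
        induction k with
        | zero =>
          intro u hu
          cases hs : s u with
          | none => rw [huniq u root hs hroot]
          | some q => exact absurd (hu q.1 q.2 hs) (by have := h.stamp_lt u q.1 q.2 hs; omega)
        | succ k ih =>
          intro u hu
          cases hs : s u with
          | none => rw [huniq u root hs hroot]
          | some q =>
            refine Relation.ReflTransGen.head (b := q.2) (mem_upLinks.2 ⟨q.1, hs⟩) (ih _ ?_)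
            intro τ v hv
            have h1 := hu q.1 q.2 hs
            have h2 := h.later u q.1 q.2 hs τ v hv
            omega
      exact fun u => key t u fun τ v _ => by omega
  order := by
    intro x y w z hx hw hwx
    obtain ⟨τ, hτ⟩ := mem_upLinks.1 hx
    have key : ∀ w, Relation.TransGen (fun a b => (a, b) ∈ upLinks s) w x →
        ∃ τ' z, s w = some (τ', z) ∧ τ' < τ := by
      intro w hwx
      induction hwx using Relation.TransGen.head_induction_on with
      | single hab =>
        obtain ⟨τ', h1⟩ := mem_upLinks.1 hab
        exact ⟨τ', _, h1, h.later _ _ _ h1 _ _ hτ⟩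
      | head hab _ ih =>
        obtain ⟨τ', h1⟩ := mem_upLinks.1 hab
        obtain ⟨τ'', z', h2, h3⟩ := ih
        exact ⟨τ', _, h1, (h.later _ _ _ h1 _ _ h2).trans h3⟩
    obtain ⟨τ', z', h1, h2⟩ := key w hwx
    rwa [stamp_eq h1, stamp_eq hτ]
  up τ := by
    obtain ⟨S, hS⟩ := h.up τ
    have hmem : ∀ l ∈ ({l ∈ upLinks s | stamp s l = τ} : Finset (Link n)),
        s l.1 = some (τ, l.2) := by
      rintro ⟨u, v⟩ hl
      obtain ⟨hl, hst⟩ := Finset.mem_filter.1 hl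
      obtain ⟨τ', h1⟩ := mem_upLinks.1 hl
      rw [stamp_eq h1] at hst
      exact hst ▸ h1
    refine G.feasible_of_receives hN (S := S) (P := fun _ => G.roundPower (τ / m + 1)) ?_
      (fun _ _ => rfl) (fun _ => (roundPower_pos G hβ hN _).le) fun l hl => hS _ _ (hmem l hl)
    rintro ⟨u, v⟩ hl ⟨u', v'⟩ hl' (rfl : u = u')
    have h1 := hmem _ hl
    have h2 := hmem _ hl'
    simp only at h1 h2
    rw [h1] at h2
    simpa using h2
  down τ := by
    obtain ⟨S, hS⟩ := h.down τ
    have hmem : ∀ l ∈ dual ({l ∈ upLinks s | stamp s l = τ} : Finset (Link n)),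
        s l.2 = some (τ, l.1) := by
      intro l hl
      obtain ⟨⟨u, v⟩, hl', rfl⟩ := Finset.mem_image.1 hl
      obtain ⟨hl', hst⟩ := Finset.mem_filter.1 hl'
      obtain ⟨τ', h1⟩ := mem_upLinks.1 hl'
      rw [stamp_eq h1] at hst
      exact hst ▸ h1
    refine G.feasible_of_receives hN (S := S) (P := fun _ => G.roundPower (τ / m + 1)) ?_
      (fun _ _ => rfl) (fun _ => (roundPower_pos G hβ hN _).le) fun l hl => hS _ _ (hmem l hl)
    rintro ⟨u, v⟩ hl ⟨u', v'⟩ hr (rfl : u = u')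
    simp only [Prod.mk.injEq, true_and]
    exact h.inj v v' τ u (hmem _ hl) (hmem _ hr)

/-! ### Success probability in one slot-pair of the construction -/

/-- A bound on the influence of an active node `w` at `v` in round `r + 1`, when active nodes have
distance at least `2 ^ r`. -/
def Net.pull (G : Net n) (r : ℕ) (s : TreeState n) (v w : Fin n) : ℝ :=
  if s w = none ∧ w ≠ v then
    max 1 (2 * G.β) * 2 ^ G.α * (max 1 (dist (G.pos v) (G.pos w) / 2 ^ r)) ^ (-G.α)
  else 0

lemma Net.pull_nonneg (G : Net n) (r : ℕ) (s : TreeState n) (v w : Fin n) :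
    0 ≤ G.pull r s v w := by
  unfold Net.pull
  split_ifs <;> positivity

/-- The active nodes have pairwise distance at least `2 ^ r`. -/
def Net.ActiveSep (G : Net n) (r : ℕ) (s : TreeState n) : Prop :=
  ∀ x y, s x = none → s y = none → x ≠ y → (2 : ℝ) ^ r ≤ G.d x y

/-- Between separated nodes the inner maximum is inactive. The factor max(1, 2β) has two purposes:
2β makes the pull at least the received power divided by `N`, and 1 makes every node within 2^(r+1)
pull with strength at least 1. -/
lemma Net.ActiveSep.pull_eq {G : Net n} {r : ℕ} {s : TreeState n} (h : G.ActiveSep r s)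
    {v w : Fin n} (hv : s v = none) (hw : s w = none) (hwv : w ≠ v) :
    G.pull r s v w = max 1 (2 * G.β) * (2 ^ (((r + 1 : ℕ) : ℝ) * G.α) / G.d w v ^ G.α) := by
  have h1 : (2 : ℝ) ^ r ≤ dist (G.pos v) (G.pos w) := h v w hv hw hwv.symm
  have h2 : (0 : ℝ) < 2 ^ r := by positivity
  have h3 : 0 < dist (G.pos v) (G.pos w) := h2.trans_le h1
  have h4 : (1 : ℝ) ≤ dist (G.pos v) (G.pos w) / 2 ^ r := (one_le_div h2).2 h1
  rw [Net.pull, if_pos ⟨hw, hwv⟩, max_eq_right h4, Net.d, dist_comm (G.pos w),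
    Real.rpow_neg (by positivity), Real.div_rpow h3.le h2.le, inv_div, mul_assoc,
    ← mul_div_assoc, ← Real.mul_rpow (by norm_num) h2.le, Real.rpow_mul (by norm_num),
    Real.rpow_natCast, pow_succ, mul_comm (2 : ℝ) (2 ^ r)]

/-- The round power makes the signal at least 2βN within distance 2^(r+1), and a total pull below 1
keeps the interference below `N`; the ratio is then at least 2βN / (N + N) = β. -/
lemma Net.ActiveSep.receives {G : Net n} {r : ℕ} {s : TreeState n} (h : G.ActiveSep r s)
    (hα : 0 < G.α) (hβ : 0 < G.β) (hN : 0 < G.N) {S : Finset (Fin n)} {u v : Fin n}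
    (hS : ∀ w ∈ S, s w = none) (hv : s v = none) (hu : u ∈ S) (hvS : v ∉ S)
    (hd : G.d u v < 2 ^ (r + 1)) (hsum : ∑ w ∈ S.erase u, G.pull r s v w < 1) :
    G.Receives S (fun _ => G.roundPower (r + 1)) u v := by
  have hne : ∀ w ∈ S, w ≠ v := fun w hw hwv => hvS (hwv ▸ hw)
  have hpos : ∀ w ∈ S, 0 < G.d w v := fun w hw =>
    lt_of_lt_of_le (by positivity) (h w v (hS w hw) hv (hne w hw))
  refine ⟨hu, hvS, ?_⟩
  set Q : ℝ := 2 ^ (((r + 1 : ℕ) : ℝ) * G.α) with hQ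
  have hQ' : Q = (2 ^ (r + 1) : ℝ) ^ G.α := by
    rw [hQ, Real.rpow_mul (by norm_num), Real.rpow_natCast]
  have hQ0 : 0 < Q := by positivity
  have hsig : 2 * G.β * G.N ≤ G.roundPower (r + 1) / G.d u v ^ G.α := by
    rw [le_div_iff₀ (Real.rpow_pos_of_pos (hpos u hu) _), Net.roundPower, ← hQ]
    refine mul_le_mul_of_nonneg_left ?_ (by positivity)
    rw [hQ']
    exact Real.rpow_le_rpow (hpos u hu).le hd.le hα.le
  have hint : ∑ w ∈ S.erase u, G.roundPower (r + 1) / G.d w v ^ G.α ≤ G.N := by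
    have h1 : ∀ w ∈ S.erase u, G.roundPower (r + 1) / G.d w v ^ G.α ≤ G.N * G.pull r s v w := by
      intro w hw
      have hw' := Finset.mem_of_mem_erase hw
      rw [h.pull_eq hv (hS w hw') (hne w hw'), Net.roundPower, ← hQ]
      have h2 : 0 ≤ Q / G.d w v ^ G.α :=
        div_nonneg hQ0.le (Real.rpow_nonneg (hpos w hw').le _)
      calc 2 * G.β * G.N * Q / G.d w v ^ G.α
          = G.N * (2 * G.β * (Q / G.d w v ^ G.α)) := by ring
        _ ≤ G.N * (max 1 (2 * G.β) * (Q / G.d w v ^ G.α)) := by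
          gcongr
          exact le_max_right _ _
    refine (Finset.sum_le_sum h1).trans ?_
    rw [← Finset.mul_sum]
    nlinarith
  have hint0 : 0 ≤ ∑ w ∈ S.erase u, G.roundPower (r + 1) / G.d w v ^ G.α :=
    Finset.sum_nonneg fun w hw => div_nonneg (roundPower_pos G hβ hN _).le
      (Real.rpow_nonneg dist_nonneg _)
  rw [le_div_iff₀ (by linarith)]
  nlinarith

/-- `x` shows `true`, `y` shows `false`, and the other nodes that show `true` have little influence
at `y`. -/
def Net.Quiet (G : Net n) (r : ℕ) (s : TreeState n) (x y : Fin n) (b : Fin n → Bool) : Prop :=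
  b x = true ∧ b y = false ∧ ∑ w with w ≠ x ∧ b w = true, G.pull r s y w < 1

/-- The first coins give silence around `v`, the second coins silence around `u`. A rival in range
would pull with strength at least 1, so `v` hears only `u`, even if β < 1. The acknowledging nodes
are among those with second coin `true`, so the acknowledgment arrives. -/
lemma Net.ActiveSep.treeStep_ne_none {G : Net n} {r t : ℕ} {s : TreeState n}
    (h : G.ActiveSep r s) (hα : 0 < G.α) (hβ : 0 < G.β) (hN : 0 < G.N) {u v : Fin n}
    (hu : s u = none) (hv : s v = none) (hd : (2 : ℝ) ^ r ≤ G.d u v)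
    (hd' : G.d u v < 2 ^ (r + 1)) {b a : Fin n → Bool} (hb : G.Quiet r s u v b)
    (ha : G.Quiet r s v u a) : G.treeStep (r + 1) t s b a u ≠ none := by
  obtain ⟨hbu, hbv, hbs⟩ := hb
  obtain ⟨hav, hau, has⟩ := ha
  have hsumb : ∑ w ∈ (broadcasters s b).erase u, G.pull r s v w < 1 := by
    refine lt_of_le_of_lt (Finset.sum_le_sum_of_subset_of_nonneg ?_
      fun w _ _ => G.pull_nonneg r s v w) hbs
    intro w hw
    simp only [broadcasters, Finset.mem_erase, Finset.mem_filter, Finset.mem_univ,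
      true_and] at hw ⊢
    exact ⟨hw.1, hw.2.2⟩
  have hrec : G.Receives (broadcasters s b) (fun _ => G.roundPower (r + 1)) u v :=
    h.receives hα hβ hN (fun w hw => by simp [broadcasters] at hw; exact hw.1) hv
      (by simp [broadcasters, hu, hbu]) (by simp [broadcasters, hbv]) hd' hsumb
  have hheard : G.heard (r + 1) s b v = some u := by
    rw [Net.heard, if_pos ⟨hv, hbv⟩]
    apply pick_eq_some_of_forall_eq
    · simp only [Finset.mem_filter, Finset.mem_univ, true_and]
      exact ⟨hrec, hd, hd'⟩
    · intro w hw
      simp only [Finset.mem_filter, Finset.mem_univ, true_and] at hw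
      by_contra hwu
      have hwb := hw.1.1
      have hws : s w = none := by simp [broadcasters] at hwb; exact hwb.1
      have hwv : w ≠ v := by
        rintro rfl
        simp [broadcasters, hbv] at hwb
      have h1 : G.pull r s v w ≤ ∑ w ∈ (broadcasters s b).erase u, G.pull r s v w :=
        Finset.single_le_sum (f := fun w => G.pull r s v w) (fun w _ => G.pull_nonneg r s v w)
          (Finset.mem_erase.2 ⟨hwu, hwb⟩)
      have h0 : 0 < G.d w v := lt_of_lt_of_le (by positivity) (h w v hws hv hwv)
      have h2 : 1 ≤ 2 ^ (((r + 1 : ℕ) : ℝ) * G.α) / G.d w v ^ G.α := by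
        rw [one_le_div (Real.rpow_pos_of_pos h0 _), Real.rpow_mul (by norm_num),
          Real.rpow_natCast]
        exact Real.rpow_le_rpow h0.le hw.2.2.le hα.le
      rw [h.pull_eq hv hws hwv] at h1
      have h3 := le_max_left 1 (2 * G.β)
      nlinarith
  have hack : G.Receives (G.ackers (r + 1) s b a) (fun _ => G.roundPower (r + 1)) v u := by
    have hS : ∀ w ∈ G.ackers (r + 1) s b a, s w = none ∧ b w = false ∧ a w = true := by
      intro w hw
      simp only [Net.ackers, Finset.mem_filter, Finset.mem_univ, true_and] at hw
      obtain ⟨x, hx⟩ := Option.isSome_iff_exists.1 hw.1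
      exact ⟨(Net.heard_eq_some hx).1, (Net.heard_eq_some hx).2.1, hw.2⟩
    refine h.receives hα hβ hN (fun w hw => (hS w hw).1) hu
      (by simp [Net.ackers, hheard, hav]) (fun hw => by simp [(hS u hw).2.1] at hbu)
      (by rwa [Net.d, dist_comm]) ?_
    refine lt_of_le_of_lt (Finset.sum_le_sum_of_subset_of_nonneg ?_
      fun w _ _ => G.pull_nonneg r s u w) has
    intro w hw
    rw [Finset.mem_erase] at hw
    simp only [Finset.mem_filter, Finset.mem_univ, true_and]
    exact ⟨hw.1, (hS w hw.2).2.2⟩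
  rw [Net.treeStep, if_pos (by simp [broadcasters, hu, hbu])]
  obtain ⟨x, hx⟩ := exists_pick_eq_some (A := {v | G.heard (r + 1) s b v = some u ∧
    G.Receives (G.ackers (r + 1) s b a) (fun _ => G.roundPower (r + 1)) v u})
    ⟨v, by simp [hheard, hack]⟩
  rw [hx]
  simp

/-- Turning `x` on costs p, and keeping `y` and the at most `k` exceptional nodes silent costs at
most (1 - p)^(k+1). The pull of all other nodes sums to at most 1, so Markov's inequality costs one
more factor 1 - p. -/
lemma exists_quiet_prob {α β p : ℝ} (hα : 2 < α) (hp₀ : 0 < p) (hp : p ≤ 1 / 2) :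
    ∃ c : ℝ, 0 < c ∧ c < 1 ∧ ∀ (n : ℕ) (G : Net n) (r : ℕ) (s : TreeState n) (x y : Fin n),
      G.α = α → G.β = β → G.ActiveSep r s → x ≠ y →
      c ≤ coinMean p fun b => if G.Quiet r s x y b then 1 else 0 := by
  have hB : 0 < max 1 (2 * β) * 2 ^ α := by positivity
  obtain ⟨k, hk⟩ := exists_packing_tail hα (inv_pos.2 hB)
  have hp1 : 0 < 1 - p := by linarith
  refine ⟨p * (1 - p) ^ (k + 2), by positivity, ?_, ?_⟩
  · have : (1 - p) ^ (k + 2) ≤ 1 := pow_le_one₀ hp1.le (by linarith)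
    nlinarith
  intro n G r s x y hGα hGβ hsep hxy
  obtain ⟨B, hBV, hBk, hBs⟩ := hk ({w | s w = none} : Finset (Fin n)) G.pos (2 ^ r) (G.pos y)
    (by positivity) (fun a ha b hb hab => hsep a b (by simpa using ha) (by simpa using hb) hab)
  -- `y` has to be silent in order to listen; `x` is removed because it has to transmit.
  set O : Finset (Fin n) := (insert y B).erase x with hO
  have hcard : O.card ≤ k + 1 :=
    (Finset.card_erase_le.trans (Finset.card_insert_le _ _)).trans (by omega)
  have hfar : ∑ w ∈ (insert x O)ᶜ, G.pull r s y w ≤ 1 := by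
    have h1 : ∑ w ∈ (insert x O)ᶜ, G.pull r s y w ≤
        ∑ w ∈ ({w | s w = none} : Finset (Fin n)) \ B,
          max 1 (2 * β) * 2 ^ α * (max 1 (dist (G.pos y) (G.pos w) / 2 ^ r)) ^ (-α) := by
      rw [← Finset.sum_filter_add_sum_filter_not _ (fun w => s w = none)]
      rw [Finset.sum_eq_zero (s := Finset.filter (fun w => ¬ s w = none) _), add_zero]
      · refine (Finset.sum_le_sum (g := fun w => max 1 (2 * β) * 2 ^ α *
          (max 1 (dist (G.pos y) (G.pos w) / 2 ^ r)) ^ (-α)) fun w _ => ?_).trans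
          (Finset.sum_le_sum_of_subset_of_nonneg ?_ fun w _ _ => by positivity)
        · rw [Net.pull, hGα, hGβ]
          split_ifs
          · exact le_rfl
          · positivity
        · intro w hw
          simp only [hO, Finset.mem_filter, Finset.mem_compl, Finset.mem_insert,
            Finset.mem_erase, Finset.mem_sdiff, Finset.mem_univ, true_and] at hw ⊢
          tauto
      · intro w hw
        rw [Net.pull, if_neg]
        exact fun h => (Finset.mem_filter.1 hw).2 h.1
    refine h1.trans ?_
    rw [← Finset.mul_sum]
    calc _ ≤ max 1 (2 * β) * 2 ^ α * (max 1 (2 * β) * 2 ^ α)⁻¹ :=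
          mul_le_mul_of_nonneg_left hBs hB.le
      _ = 1 := mul_inv_cancel₀ hB.ne'
  have key := le_coinMean_weight_lt_one hp₀.le (by linarith) x O (by simp [hO])
    (fun w => G.pull r s y w) (fun w => G.pull_nonneg r s y w)
  refine le_trans ?_ (key.trans (coinMean_mono hp₀.le (by linarith) fun b => ?_))
  · have h1 : (1 - p) ^ (k + 1) ≤ (1 - p) ^ O.card :=
      pow_le_pow_of_le_one hp1.le (by linarith) hcard
    have h2 : 1 - p ≤ 1 - p * ∑ w ∈ (insert x O)ᶜ, G.pull r s y w := by nlinarith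
    calc p * (1 - p) ^ (k + 2) = p * (1 - p) ^ (k + 1) * (1 - p) := by ring
      _ ≤ p * (1 - p) ^ O.card * (1 - p * ∑ w ∈ (insert x O)ᶜ, G.pull r s y w) :=
        mul_le_mul (mul_le_mul_of_nonneg_left h1 hp₀.le) h2 hp1.le (by positivity)
  · by_cases hq : G.Quiet r s x y b
    · rw [if_pos hq]; split_ifs <;> norm_num
    · rw [if_neg hq, if_neg]
      rintro ⟨h1, h2, h3⟩
      exact hq ⟨h1, h2 y (by simp [hO, hxy.symm]), h3⟩

/-- An active node with another active node in the range of the current round becomes inactive with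
constant probability. -/
lemma exists_success_prob {α β p : ℝ} (hα : 2 < α) (hβ : 0 < β) (hp₀ : 0 < p) (hp : p ≤ 1 / 2) :
    ∃ c : ℝ, 0 < c ∧ c < 1 ∧ ∀ (n : ℕ) (G : Net n) (r t : ℕ) (s : TreeState n) (u v : Fin n),
      G.α = α → G.β = β → 0 < G.N → G.ActiveSep r s → s u = none → s v = none →
      (2 : ℝ) ^ r ≤ G.d u v → G.d u v < 2 ^ (r + 1) →
      coinMean p (fun b => coinMean p fun a =>
        if G.treeStep (r + 1) t s b a u = none then 1 else 0) ≤ 1 - c := by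
  obtain ⟨c, hc0, hc1, hc⟩ := exists_quiet_prob (β := β) hα hp₀ hp
  -- The two slots use independent coins, so both are quiet with probability at least c².
  refine ⟨c * c, by positivity, by nlinarith, ?_⟩
  intro n G r t s u v hGα hGβ hN hsep hu hv hd hd'
  have huv : u ≠ v := by
    rintro rfl
    rw [Net.d, dist_self] at hd
    exact absurd hd (not_le.2 (by positivity))
  have hp1 : p ≤ 1 := by linarith
  have hle : ∀ b a, (if G.treeStep (r + 1) t s b a u = none then (1 : ℝ) else 0) ≤
      1 - (if G.Quiet r s u v b then 1 else 0) * (if G.Quiet r s v u a then 1 else 0) := by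
    intro b a
    by_cases hb : G.Quiet r s u v b
    · by_cases ha : G.Quiet r s v u a
      · rw [if_neg (hsep.treeStep_ne_none (by linarith) (by linarith) hN hu hv hd hd' hb ha)]
        simp [hb, ha]
      · simp only [ha, if_false, mul_zero, sub_zero]
        split_ifs <;> norm_num
    · simp only [hb, if_false, zero_mul, sub_zero]
      split_ifs <;> norm_num
  refine (coinMean_mono hp₀.le hp1 fun b => coinMean_mono hp₀.le hp1 fun a => hle b a).trans ?_
  simp only [coinMean_sub, coinMean_const, coinMean_const_mul, coinMean_mul_const]
  have h1 := hc n G r s u v hGα hGβ hsep huv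
  have h2 := hc n G r s v u hGα hGβ hsep huv.symm
  linarith [mul_le_mul h1 h2 hc0.le (hc0.le.trans h1)]

/-! ### Separation of the active nodes and degrees in the tree -/

/-- In the history recorded in `s`, the node `x` was active at the beginning of slot-pair `t₀`. -/
def ActiveAt (s : TreeState n) (t₀ : ℕ) (x : Fin n) : Prop :=
  ∀ τ v, s x = some (τ, v) → t₀ ≤ τ

/-- The nodes active after `i` rounds of `m` slot-pairs have distance at least `2 ^ i`. -/
def Net.SepAt (G : Net n) (m i : ℕ) (s : TreeState n) : Prop :=
  ∀ x y, ActiveAt s (i * m) x → ActiveAt s (i * m) y → x ≠ y → (2 : ℝ) ^ i ≤ G.d x y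

/-- The separation of the active nodes at the beginning of all rounds started by slot-pair `t`. -/
def Net.SepUpTo (G : Net n) (m t : ℕ) (s : TreeState n) : Prop :=
  ∀ i, i * m ≤ t → G.SepAt m i s

/-- The nodes with parent `x`. -/
def children (s : TreeState n) (x : Fin n) : Finset (Fin n) := {u | ∃ τ, s u = some (τ, x)}

lemma Net.d_comm (G : Net n) (x y : Fin n) : G.d x y = G.d y x := dist_comm _ _

lemma activeAt_of_eq_none {s : TreeState n} {x : Fin n} (h : s x = none) (t₀ : ℕ) :
    ActiveAt s t₀ x := by
  intro τ v hv
  simp [h] at hv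

lemma ActiveAt.mono {s : TreeState n} {t₀ t₁ : ℕ} {x : Fin n} (h : ActiveAt s t₁ x)
    (ht : t₀ ≤ t₁) : ActiveAt s t₀ x := fun τ v hv => ht.trans (h τ v hv)

lemma TreeInv.eq_none_of_activeAt {G : Net n} {m t t₀ : ℕ} {s : TreeState n}
    (h : TreeInv G m t s) (ht : t ≤ t₀) {x : Fin n} (hx : ActiveAt s t₀ x) : s x = none := by
  by_contra hne
  obtain ⟨⟨τ, v⟩, hv⟩ := Option.ne_none_iff_exists'.1 hne
  have := h.stamp_lt x τ v hv
  have := hx τ v hv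
  omega

/-- Formed links are never revised and new stamps are at least `t₀`, so the past can be read off any
later state. This lets potentials refer to earlier rounds. -/
lemma Net.activeAt_treeStep (G : Net n) {r t t₀ : ℕ} (ht : t₀ ≤ t) {s : TreeState n}
    {b a : Fin n → Bool} {x : Fin n} :
    ActiveAt (G.treeStep r t s b a) t₀ x ↔ ActiveAt s t₀ x := by
  constructor
  · intro h τ v hv
    refine h τ v ?_
    rw [G.treeStep_of_ne_none (by simp [hv]), hv]
  · intro h τ v hv
    rcases G.treeStep_eq_some hv with h1 | ⟨_, _, rfl, _⟩
    · exact h τ v h1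
    · exact ht

lemma Net.sepAt_treeStep (G : Net n) {m i r t : ℕ} (ht : i * m ≤ t) {s : TreeState n}
    {b a : Fin n → Bool} : G.SepAt m i (G.treeStep r t s b a) ↔ G.SepAt m i s := by
  simp only [Net.SepAt, G.activeAt_treeStep ht]

lemma Net.SepAt.activeSep {G : Net n} {m i : ℕ} {s : TreeState n} (h : G.SepAt m i s) :
    G.ActiveSep i s :=
  fun x y hx hy => h x y (activeAt_of_eq_none hx _) (activeAt_of_eq_none hy _)

/-- A potential of the construction that never increases in expectation. -/
lemma Net.treeRun_mean_le (G : Net n) (hn : 0 < n) (p : unitInterval) (m T : ℕ)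
    (Φ : ℕ → TreeState n → ℝ) (hΦ : ∀ t s, 0 ≤ Φ t s)
    (hstep : ∀ t < T, ∀ s, TreeInv G m t s → coinMean p (fun b => coinMean p fun a =>
      Φ (t + 1) (G.treeStep (t / m + 1) t s b a)) ≤ Φ t s) :
    mean (G.treeRun p m T) (fun s => ENNReal.ofReal (Φ T s)) ≤
      ENNReal.ofReal (Φ 0 fun _ => none) := by
  refine chain_mean_le (μ := G.treeRun p m) (I := TreeInv G m)
    (κ := fun t s => (coins (Fin n) p).bind fun b =>
      (coins (Fin n) p).bind fun a => PMF.pure (G.treeStep (t / m + 1) t s b a))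
    rfl (fun t => rfl) (treeInv_zero G hn m) ?_ (fun t s => ENNReal.ofReal (Φ t s)) T ?_
  · intro t s hs s' hs'
    simp only [PMF.mem_support_bind_iff, PMF.mem_support_pure_iff] at hs'
    obtain ⟨b, -, a, -, rfl⟩ := hs'
    exact hs.step b a
  · intro t ht s hs
    simp only [mean_bind, mean_pure]
    have h1 : ∀ b : Fin n → Bool, 0 ≤ coinMean (p : ℝ) fun a : Fin n → Bool =>
        Φ (t + 1) (G.treeStep (t / m + 1) t s b a) :=
      fun b => coinMean_nonneg p.2.1 p.2.2 fun a => hΦ _ _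
    simp only [mean_coins p fun a => hΦ (t + 1) (G.treeStep (t / m + 1) t s _ a)]
    rw [mean_coins p h1]
    exact ENNReal.ofReal_le_ofReal (hstep t ht s hs)

lemma Net.treeRun_support (G : Net n) (hn : 0 < n) (p : unitInterval) (m T : ℕ) :
    ∀ s ∈ (G.treeRun p m T).support, TreeInv G m T s := by
  refine chain_support (μ := G.treeRun p m) (I := TreeInv G m)
    (κ := fun t s => (coins (Fin n) p).bind fun b =>
      (coins (Fin n) p).bind fun a => PMF.pure (G.treeStep (t / m + 1) t s b a))
    rfl (fun t => rfl) (treeInv_zero G hn m) ?_ T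
  intro t s hs s' hs'
  simp only [PMF.mem_support_bind_iff, PMF.mem_support_pure_iff] at hs'
  obtain ⟨b, -, a, -, rfl⟩ := hs'
  exact hs.step b a

/-- The bound on the probability to stay active that `exists_success_prob` provides. -/
def Net.StepBound (G : Net n) (p c : ℝ) : Prop :=
  ∀ (r t : ℕ) (s : TreeState n) (u v : Fin n), G.ActiveSep r s → s u = none → s v = none →
    (2 : ℝ) ^ r ≤ G.d u v → G.d u v < 2 ^ (r + 1) →
    coinMean p (fun b => coinMean p fun a =>
      if G.treeStep (r + 1) t s b a u = none then 1 else 0) ≤ 1 - c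

/-- It is unlikely that two nodes are both active at the end of the round responsible for their
distance. -/
lemma Net.pair_active_prob (G : Net n) (hn : 0 < n) (p : unitInterval) {c : ℝ}
    (hc1 : c ≤ 1) (hc : G.StepBound p c) {m r T : ℕ} (hT : (r + 1) * m ≤ T) {u v : Fin n}
    (hd : (2 : ℝ) ^ r ≤ G.d u v) (hd' : G.d u v < 2 ^ (r + 1)) :
    mean (G.treeRun p m T) (fun s => ENNReal.ofReal (if G.SepAt m r s ∧
      ActiveAt s ((r + 1) * m) u ∧ ActiveAt s ((r + 1) * m) v then 1 else 0)) ≤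
      ENNReal.ofReal ((1 - c) ^ m) := by
  have hc0 : 0 ≤ 1 - c := by linarith
  set t₂ := (r + 1) * m with ht₂
  have ht12 : t₂ = r * m + m := by rw [ht₂]; ring
  -- The potential bounds the conditional probability of the event: constant before the round, one
  -- factor 1 - c per remaining slot-pair during it while both nodes are active, and the indicator
  -- of the event afterwards. It includes `SepAt` because the step bound is available only under
  -- separation.
  set Φ : ℕ → TreeState n → ℝ := fun t s => if t < r * m then (1 - c) ^ m else
    if G.SepAt m r s ∧ ActiveAt s (min t t₂) u ∧ ActiveAt s (min t t₂) v
      then (1 - c) ^ (t₂ - t) else 0 with hΦ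
  have hΦ0 : ∀ t s, 0 ≤ Φ t s := by
    intro t s
    simp only [hΦ]
    split_ifs <;> positivity
  have hlate : ∀ t s, r * m ≤ t → Φ t s =
      if G.SepAt m r s ∧ ActiveAt s (min t t₂) u ∧ ActiveAt s (min t t₂) v
        then (1 - c) ^ (t₂ - t) else 0 := fun t s h => by
    simp only [hΦ]
    exact if_neg (not_lt.2 h)
  have hp₀ := p.2.1
  have hp₁ := p.2.2
  have key := G.treeRun_mean_le hn p m T Φ hΦ0 ?_
  · refine le_trans (mean_mono_of_support _ fun s _ => ENNReal.ofReal_le_ofReal ?_)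
      (key.trans (ENNReal.ofReal_le_ofReal ?_))
    · rw [hlate T s (by omega), min_eq_right hT, Nat.sub_eq_zero_of_le hT, pow_zero]
    · simp only [hΦ]
      split_ifs with h1 h2
      · exact le_rfl
      · have : r * m = 0 := by omega
        rw [ht12, this]; simp
      · positivity
  intro t ht s hs
  by_cases h1 : t < r * m
  · have h2 : Φ t s = (1 - c) ^ m := by simp only [hΦ]; rw [if_pos h1]
    rw [h2]
    have h3 : ∀ s', Φ (t + 1) s' ≤ (1 - c) ^ m := by
      intro s'
      simp only [hΦ]
      split_ifs with h4 h5
      · exact le_rfl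
      · rw [show t₂ - (t + 1) = m by omega]
      · positivity
    refine (coinMean_mono hp₀ hp₁ fun b => coinMean_mono hp₀ hp₁ fun a => h3 _).trans ?_
    simp [coinMean_const]
  by_cases h2 : t < t₂
  · have hr : t / m = r := by
      have hm : 0 < m := by
        rcases Nat.eq_zero_or_pos m with h0 | h0
        · subst h0; omega
        · exact h0
      rw [Nat.div_eq_iff hm]
      constructor
      · omega
      · rw [← ht12.symm.trans ht₂] at *
        omega
    by_cases h3 : G.SepAt m r s ∧ s u = none ∧ s v = none
    · have h4 : Φ t s = (1 - c) ^ (t₂ - t) := by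
        simp only [hΦ]
        rw [if_neg h1, if_pos ⟨h3.1, activeAt_of_eq_none h3.2.1 _, activeAt_of_eq_none h3.2.2 _⟩]
      have h5 : ∀ b a, Φ (t + 1) (G.treeStep (t / m + 1) t s b a) ≤ (1 - c) ^ (t₂ - (t + 1)) *
          (if G.treeStep (r + 1) t s b a u = none then 1 else 0) := by
        intro b a
        have h6 := hs.step b a
        simp only [hΦ, hr] at h6 ⊢
        rw [if_neg (by omega)]
        split_ifs with h7 h8 h8
        · simp
        · exact absurd (h6.eq_none_of_activeAt (by omega) h7.2.1) h8
        · simp only [mul_one]; positivity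
        · simp
      refine (coinMean_mono hp₀ hp₁ fun b => coinMean_mono hp₀ hp₁ fun a => h5 b a).trans ?_
      simp only [coinMean_const_mul]
      rw [h4, show t₂ - t = t₂ - (t + 1) + 1 by omega, pow_succ]
      exact mul_le_mul_of_nonneg_left
        (hc r t s u v h3.1.activeSep h3.2.1 h3.2.2 hd hd') (by positivity)
    · have h5 : ∀ b a, Φ (t + 1) (G.treeStep (t / m + 1) t s b a) = 0 := by
        intro b a
        simp only [hΦ]
        rw [if_neg (by omega), if_neg]
        rintro ⟨h6, h7, h8⟩
        refine h3 ⟨(G.sepAt_treeStep (by omega)).1 h6, ?_, ?_⟩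
        · exact hs.eq_none_of_activeAt le_rfl
            ((G.activeAt_treeStep le_rfl).1 (h7.mono (by omega)))
        · exact hs.eq_none_of_activeAt le_rfl
            ((G.activeAt_treeStep le_rfl).1 (h8.mono (by omega)))
      simp only [h5, coinMean_const]
      exact hΦ0 t s
  · have h5 : ∀ b a, Φ (t + 1) (G.treeStep (t / m + 1) t s b a) = Φ t s := by
      intro b a
      rw [hlate _ _ (by omega), hlate _ _ (by omega), min_eq_right (by omega),
        min_eq_right (by omega),
        G.sepAt_treeStep (by omega), G.activeAt_treeStep (by omega),
        G.activeAt_treeStep (by omega), show t₂ - (t + 1) = t₂ - t by omega]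
    simp only [h5, coinMean_const]
    exact le_rfl

lemma Net.children_treeStep_subset (G : Net n) {r t : ℕ} {s : TreeState n} {b a : Fin n → Bool}
    {x u : Fin n} (hu : u ∈ children (G.treeStep r t s b a) x) :
    u ∈ children s x ∨ (s u = none ∧ G.heard r s b x = some u) := by
  simp only [children, Finset.mem_filter, Finset.mem_univ, true_and] at hu ⊢
  obtain ⟨τ, hτ⟩ := hu
  rcases G.treeStep_eq_some hτ with h1 | ⟨h1, _, _, h2, _⟩
  · exact Or.inl ⟨τ, h1⟩
  · exact Or.inr ⟨h1, h2⟩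

lemma Net.children_treeStep_of_heard_none (G : Net n) {r t : ℕ} {s : TreeState n}
    {b a : Fin n → Bool} {x : Fin n} (h : ∀ u, s u = none → G.heard r s b x ≠ some u) :
    (children (G.treeStep r t s b a) x).card ≤ (children s x).card := by
  refine Finset.card_le_card fun u hu => ?_
  rcases G.children_treeStep_subset hu with h1 | h1
  · exact h1
  · exact absurd h1.2 (h u h1.1)

/-- A node hears at most one broadcaster per slot-pair. -/
lemma Net.card_children_treeStep_le (G : Net n) {r t : ℕ} {s : TreeState n}
    {b a : Fin n → Bool} {x : Fin n} :
    (children (G.treeStep r t s b a) x).card ≤ (children s x).card + 1 := by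
  cases h : G.heard r s b x with
  | none =>
    exact (G.children_treeStep_of_heard_none fun u _ => by simp [h]).trans (Nat.le_succ _)
  | some w =>
    refine (Finset.card_le_card (t := insert w (children s x)) fun u hu => ?_).trans
      (Finset.card_insert_le _ _)
    rw [Finset.mem_insert]
    rcases G.children_treeStep_subset hu with h1 | h1
    · exact Or.inr h1
    · rw [h] at h1; exact Or.inl (Option.some.inj h1.2).symm

/-- It is unlikely that a node gets many children. -/
lemma Net.children_prob (G : Net n) (hn : 0 < n) (p : unitInterval) {c : ℝ}
    (hc0 : 0 ≤ c) (hc1 : c ≤ 1) (hc : G.StepBound p c) (m T k : ℕ) (x : Fin n) :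
    mean (G.treeRun p m T) (fun s => ENNReal.ofReal
      (if G.SepUpTo m T s ∧ k ≤ (children s x).card then 1 else 0)) ≤
      ENNReal.ofReal ((1 - c) ^ k) := by
  have hc2 : 0 ≤ 1 - c := by linarith
  have hc3 : 1 - c ≤ 1 := by linarith
  have hp₀ := p.2.1
  have hp₁ := p.2.2
  -- A new child raises the potential of an active `x` by the factor 1/(1 - c) at most. It needs an
  -- active node in range, and then `x` drops out, with potential falling to 0, with probability at
  -- least `c`. Truncated subtraction keeps the value 1 once there are `k` children.
  set Φ : ℕ → TreeState n → ℝ := fun t s =>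
    if G.SepUpTo m t s ∧ (s x = none ∨ k ≤ (children s x).card) then
      (1 - c) ^ (k - (children s x).card) else 0 with hΦ
  have hΦ0 : ∀ t s, 0 ≤ Φ t s := by
    intro t s
    simp only [hΦ]
    split_ifs <;> positivity
  have key := G.treeRun_mean_le hn p m T Φ hΦ0 ?_
  · refine le_trans (mean_mono_of_support _ fun s _ => ENNReal.ofReal_le_ofReal ?_)
      (key.trans (ENNReal.ofReal_le_ofReal ?_))
    · split_ifs with h
      · simp only [hΦ]
        rw [if_pos ⟨h.1, Or.inr h.2⟩, Nat.sub_eq_zero_of_le h.2, pow_zero]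
      · exact hΦ0 _ _
    · simp only [hΦ]
      split_ifs with h1
      · simp [children]
      · positivity
  intro t ht s hs
  by_cases hgood : G.SepUpTo m t s
  swap
  · have h5 : ∀ b a, Φ (t + 1) (G.treeStep (t / m + 1) t s b a) = 0 := by
      intro b a
      simp only [hΦ]
      rw [if_neg]
      rintro ⟨h6, -⟩
      exact hgood fun i hi => (G.sepAt_treeStep hi).1 (h6 i (by omega))
    simp only [h5, coinMean_const]
    exact hΦ0 t s
  by_cases hk : k ≤ (children s x).card
  · have h5 : ∀ s', Φ (t + 1) s' ≤ 1 := by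
      intro s'
      simp only [hΦ]
      split_ifs
      · exact pow_le_one₀ hc2 hc3
      · norm_num
    refine (coinMean_mono hp₀ hp₁ fun b => coinMean_mono hp₀ hp₁ fun a => h5 _).trans ?_
    simp only [coinMean_const, hΦ]
    rw [if_pos ⟨hgood, Or.inr hk⟩, Nat.sub_eq_zero_of_le hk, pow_zero]
  by_cases hx : s x = none
  swap
  · have h5 : ∀ b a, Φ (t + 1) (G.treeStep (t / m + 1) t s b a) = 0 := by
      intro b a
      simp only [hΦ]
      rw [if_neg]
      rintro ⟨-, h6 | h6⟩
      · rw [G.treeStep_of_ne_none hx] at h6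
        exact hx h6
      · refine hk (h6.trans (G.children_treeStep_of_heard_none fun u _ h7 => ?_))
        exact hx (Net.heard_eq_some h7).1
    simp only [h5, coinMean_const]
    exact hΦ0 t s
  have hval : Φ t s = (1 - c) ^ (k - (children s x).card) := by
    simp only [hΦ]
    rw [if_pos ⟨hgood, Or.inl hx⟩]
  rw [hval]
  by_cases hy : ∃ y, s y = none ∧ (2 : ℝ) ^ (t / m) ≤ G.d x y ∧ G.d x y < 2 ^ (t / m + 1)
  · obtain ⟨y, hy, hd, hd'⟩ := hy
    have hsep : G.ActiveSep (t / m) s := (hgood (t / m) (Nat.div_mul_le_self t m)).activeSep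
    have h5 : ∀ b a, Φ (t + 1) (G.treeStep (t / m + 1) t s b a) ≤
        (1 - c) ^ (k - ((children s x).card + 1)) *
          (if G.treeStep (t / m + 1) t s b a x = none then 1 else 0) := by
      intro b a
      simp only [hΦ]
      split_ifs with h6 h7 h7
      · rw [mul_one]
        have := G.card_children_treeStep_le (r := t / m + 1) (t := t) (s := s) (b := b) (a := a)
          (x := x)
        exact pow_le_pow_of_le_one hc2 hc3 (by omega)
      -- If `x` has just become inactive, it was a broadcaster and gained no child, so it still has
      -- fewer than `k`.
      · have h8 := h6.2.resolve_left h7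
        refine absurd (h8.trans (G.children_treeStep_of_heard_none fun u _ h9 => ?_)) hk
        rw [G.treeStep_of_listener (Net.heard_eq_some h9).2.1] at h7
        exact h7 hx
      · simp only [mul_one]; positivity
      · simp
    refine (coinMean_mono hp₀ hp₁ fun b => coinMean_mono hp₀ hp₁ fun a => h5 b a).trans ?_
    simp only [coinMean_const_mul]
    rw [show k - (children s x).card = k - ((children s x).card + 1) + 1 by omega, pow_succ]
    exact mul_le_mul_of_nonneg_left (hc _ t s x y hsep hx hy hd hd') (by positivity)
  · have h5 : ∀ b a, Φ (t + 1) (G.treeStep (t / m + 1) t s b a) ≤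
        (1 - c) ^ (k - (children s x).card) := by
      intro b a
      have h6 : (children (G.treeStep (t / m + 1) t s b a) x).card ≤ (children s x).card := by
        refine G.children_treeStep_of_heard_none fun u hu h7 => hy ⟨u, hu, ?_⟩
        rw [G.d_comm]
        exact (Net.heard_eq_some h7).2.2.2
      simp only [hΦ]
      split_ifs
      · exact pow_le_pow_of_le_one hc2 hc3 (by omega)
      · positivity
    refine (coinMean_mono hp₀ hp₁ fun b => coinMean_mono hp₀ hp₁ fun a => h5 b a).trans ?_
    simp [coinMean_const]

lemma Net.d_le_Delta (G : Net n) (u v : Fin n) : G.d u v ≤ G.Delta :=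
  Metric.dist_le_diam_of_mem (Set.finite_range G.pos).isBounded ⟨u, rfl⟩ ⟨v, rfl⟩

lemma Net.Delta_lt_two_pow_rounds (G : Net n) : G.Delta < 2 ^ G.rounds := by
  have h1 : ⌊G.Delta⌋₊ + 1 ≤ 2 ^ G.rounds := Nat.lt_pow_succ_log_self (by norm_num) _
  calc G.Delta < ⌊G.Delta⌋₊ + 1 := Nat.lt_floor_add_one _
    _ ≤ 2 ^ G.rounds := by exact_mod_cast h1

/-- After the last round, all active nodes but one have become inactive. -/
lemma Net.SepUpTo.eq_of_active {G : Net n} {m : ℕ} {s : TreeState n}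
    (h : G.SepUpTo m (G.rounds * m) s) {u v : Fin n} (hu : s u = none) (hv : s v = none) :
    u = v := by
  by_contra hne
  have h1 := (h G.rounds le_rfl).activeSep u v hu hv hne
  linarith [G.d_le_Delta u v, G.Delta_lt_two_pow_rounds]

/-- With high probability, the active nodes are well separated in all rounds, and all nodes have
few children. -/
lemma Net.tree_fail_prob (G : Net n) (hn : 0 < n) (p : unitInterval) {c : ℝ}
    (hc0 : 0 ≤ c) (hc1 : c ≤ 1) (hc : G.StepBound p c)
    (hsep : ∀ u v, u ≠ v → 1 ≤ G.d u v) (m k : ℕ) :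
    (G.treeRun p m (G.rounds * m)).toOuterMeasure
      {s | ¬ (G.SepUpTo m (G.rounds * m) s ∧ ∀ x, (children s x).card < k)} ≤
      ENNReal.ofReal (n ^ 2 * (1 - c) ^ m + n * (1 - c) ^ k) := by
  have hc2 : 0 ≤ 1 - c := by linarith
  set T := G.rounds * m with hT
  have hr : ∀ u v : Fin n, u ≠ v → ∃ r, (2 : ℝ) ^ r ≤ G.d u v ∧ G.d u v < 2 ^ (r + 1) ∧
      (r + 1) * m ≤ T := by
    intro u v huv
    obtain ⟨r, h1, h2⟩ := exists_nat_pow_near (hsep u v huv) (y := 2) (by norm_num)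
    refine ⟨r, h1, h2, Nat.mul_le_mul_right m ?_⟩
    by_contra h3
    have h4 : (2 : ℝ) ^ G.rounds ≤ 2 ^ r := pow_le_pow_right₀ (by norm_num) (by omega)
    linarith [G.d_le_Delta u v, G.Delta_lt_two_pow_rounds]
  choose! r hr1 hr2 hr3 using hr
  set f : Fin n × Fin n → TreeState n → ENNReal := fun q s =>
    if q.1 ≠ q.2 then ENNReal.ofReal (if G.SepAt m (r q.1 q.2) s ∧
      ActiveAt s ((r q.1 q.2 + 1) * m) q.1 ∧ ActiveAt s ((r q.1 q.2 + 1) * m) q.2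
        then 1 else 0) else 0 with hf
  set g : Fin n → TreeState n → ENNReal := fun x s => ENNReal.ofReal
      (if G.SepUpTo m T s ∧ k ≤ (children s x).card then 1 else 0) with hg
  have hle : ∀ s, ({s | ¬ (G.SepUpTo m T s ∧ ∀ x, (children s x).card < k)} :
      Set (TreeState n)).indicator (fun _ => (1 : ENNReal)) s ≤ ∑ q, f q s + ∑ x, g x s := by
    intro s
    by_cases hs : G.SepUpTo m T s
    · by_cases hk : ∀ x, (children s x).card < k
      · rw [Set.indicator_of_notMem (by simp [hs, hk])]
        exact zero_le
      · push Not at hk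
        obtain ⟨x, hx⟩ := hk
        refine (Set.indicator_le_self' (fun _ _ => zero_le) s).trans
          (le_trans ?_ (le_add_left le_rfl))
        refine le_trans ?_ (Finset.single_le_sum (f := fun x => g x s) (fun _ _ => zero_le)
          (Finset.mem_univ x))
        simp only [hg]
        rw [if_pos ⟨hs, hx⟩]
        simp
    -- Take the first failure of separation; it is not at 0, as distances are at least 1. The
    -- offending pair was separated one round earlier, so that round is the one responsible for its
    -- distance, and both nodes survived it.
    · have hex : ∃ i, i * m ≤ T ∧ ¬ G.SepAt m i s := by
        by_contra hcon
        push Not at hcon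
        exact hs hcon
      obtain ⟨hi1, hi2⟩ := Nat.find_spec hex
      have hmin := fun j => Nat.find_min hex (m := j)
      obtain ⟨i, hi⟩ : ∃ i, Nat.find hex = i + 1 := by
        refine Nat.exists_eq_succ_of_ne_zero fun h0 => hi2 ?_
        rw [h0]
        intro x y _ _ hxy
        simpa using hsep x y hxy
      rw [hi] at hi1 hi2
      have hprev : G.SepAt m i s := by
        by_contra hcon
        exact hmin i (by omega) ⟨le_trans (Nat.mul_le_mul_right m (by omega)) hi1, hcon⟩
      unfold Net.SepAt at hi2
      push Not at hi2
      obtain ⟨u, v, hu, hv, huv, hd⟩ := hi2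
      have hmono : i * m ≤ (i + 1) * m := Nat.mul_le_mul_right m (by omega)
      have hd2 := hprev u v (hu.mono hmono) (hv.mono hmono) huv
      have hri : r u v = i := by
        have h1 : r u v < i + 1 := (pow_lt_pow_iff_right₀ (by norm_num : (1 : ℝ) < 2)).1
          ((hr1 u v huv).trans_lt hd)
        have h2 : i < r u v + 1 := (pow_lt_pow_iff_right₀ (by norm_num : (1 : ℝ) < 2)).1
          (hd2.trans_lt (hr2 u v huv))
        omega
      refine (Set.indicator_le_self' (fun _ _ => zero_le) s).trans
        (le_trans ?_ (le_add_right le_rfl))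
      refine le_trans ?_ (Finset.single_le_sum (f := fun q => f q s) (fun _ _ => zero_le)
        (Finset.mem_univ (u, v)))
      simp only [hf]
      rw [if_pos huv, hri, if_pos ⟨hprev, hu, hv⟩]
      simp
  rw [toOuterMeasure_eq_mean]
  refine (mean_mono_of_support _ fun s _ => hle s).trans ?_
  rw [mean_add, mean_sum, mean_sum, ENNReal.ofReal_add (by positivity) (by positivity)]
  refine add_le_add ?_ ?_
  · have h1 : ∀ q ∈ (Finset.univ : Finset (Fin n × Fin n)),
        mean (G.treeRun p m T) (f q) ≤ ENNReal.ofReal ((1 - c) ^ m) := by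
      intro q _
      by_cases hq : q.1 ≠ q.2
      · simp only [hf, if_pos hq]
        exact G.pair_active_prob hn p hc1 hc (hr3 _ _ hq) (hr1 _ _ hq) (hr2 _ _ hq)
      · simp only [hf, if_neg hq, mean_const]
        exact zero_le
    refine (Finset.sum_le_card_nsmul _ _ _ h1).trans (le_of_eq ?_)
    rw [nsmul_eq_mul, ENNReal.ofReal_mul (by positivity)]
    congr 1
    simp only [Finset.card_univ, Fintype.card_prod, Fintype.card_fin]
    rw [ENNReal.ofReal_pow (by positivity), ENNReal.ofReal_natCast]
    push_cast
    ring
  · refine (Finset.sum_le_card_nsmul _ _ _ fun x _ =>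
      G.children_prob hn p hc0 hc1 hc m T k x).trans (le_of_eq ?_)
    rw [nsmul_eq_mul, ENNReal.ofReal_mul (by positivity), ENNReal.ofReal_natCast]
    simp

/-! ### Conflicts between the links of the tree -/

/-- The length of a link. -/
def Net.len (G : Net n) (l : Link n) : ℝ := G.d l.1 l.2

/-- The relative strength, capped at `1`, of the mutual disturbance at distance `d x y` of two links
that use mean power. -/
def Net.cap (G : Net n) (l l' : Link n) (x y : Fin n) : ℝ :=
  (max 1 (G.d x y ^ G.α / (max 1 (2 * G.β) * (G.len l * G.len l') ^ (G.α / 2))))⁻¹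

/-- The total capped disturbance between the endpoints of two links. -/
def Net.conflict (G : Net n) (l l' : Link n) : ℝ :=
  (G.cap l l' l.1 l'.1 + G.cap l l' l.1 l'.2) + (G.cap l l' l.2 l'.1 + G.cap l l' l.2 l'.2)

lemma Net.cap_nonneg (G : Net n) (l l' : Link n) (x y : Fin n) : 0 ≤ G.cap l l' x y := by
  unfold Net.cap; positivity

lemma Net.conflict_nonneg (G : Net n) (l l' : Link n) : 0 ≤ G.conflict l l' := by
  have := G.cap_nonneg l l'
  unfold Net.conflict
  linarith [this l.1 l'.1, this l.1 l'.2, this l.2 l'.1, this l.2 l'.2]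

lemma Net.cap_comm (G : Net n) (l l' : Link n) (x y : Fin n) :
    G.cap l l' x y = G.cap l' l y x := by
  rw [Net.cap, Net.cap, G.d_comm, mul_comm (G.len l)]

/-- Symmetry is the reason for using mean power: the disturbance involves only the product of the
two lengths, so each pair can be charged to its shorter link. -/
lemma Net.conflict_comm (G : Net n) (l l' : Link n) : G.conflict l l' = G.conflict l' l := by
  rw [Net.conflict, Net.conflict, G.cap_comm l l', G.cap_comm l l', G.cap_comm l l',
    G.cap_comm l l']
  ring

lemma mem_treeLinks {s : TreeState n} {l : Link n} :
    l ∈ treeLinks s ↔ ∃ τ, s l.1 = some (τ, l.2) ∨ s l.2 = some (τ, l.1) := by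
  obtain ⟨u, v⟩ := l
  simp only [treeLinks, dual, Finset.mem_union, Finset.mem_image, Prod.exists, mem_upLinks,
    Prod.swap_prod_mk, Prod.mk.injEq]
  constructor
  · rintro (⟨τ, h⟩ | ⟨a, b, ⟨τ, h⟩, rfl, rfl⟩)
    · exact ⟨τ, Or.inl h⟩
    · exact ⟨τ, Or.inr h⟩
  · rintro ⟨τ, h | h⟩
    · exact Or.inl ⟨τ, h⟩
    · exact Or.inr ⟨v, u, ⟨τ, h⟩, rfl, rfl⟩

/-- The round in which a link of the tree was formed, together with its properties. -/
lemma TreeInv.exists_round {G : Net n} {m R : ℕ} {s : TreeState n} (h : TreeInv G m (R * m) s) :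
    ∃ ρ : Link n → ℕ, ∀ l ∈ treeLinks s, ρ l < R ∧ (2 : ℝ) ^ ρ l ≤ G.len l ∧
      G.len l < 2 ^ (ρ l + 1) ∧ ActiveAt s (ρ l * m) l.1 ∧ ActiveAt s (ρ l * m) l.2 := by
  have key : ∀ u τ v, s u = some (τ, v) → τ / m < R ∧ (2 : ℝ) ^ (τ / m) ≤ G.d u v ∧
      G.d u v < 2 ^ (τ / m + 1) ∧ ActiveAt s (τ / m * m) u ∧ ActiveAt s (τ / m * m) v := by
    intro u τ v hu
    have h1 := h.len u τ v hu
    have h2 := Nat.div_mul_le_self τ m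
    refine ⟨?_, h1.1, h1.2, ?_, ?_⟩
    · exact Nat.div_lt_of_lt_mul (by rw [mul_comm]; exact h.stamp_lt u τ v hu)
    · intro τ' v' hu'
      rw [hu] at hu'
      obtain ⟨rfl, rfl⟩ := Prod.mk.inj (Option.some.inj hu')
      exact h2
    · intro τ' v' hv
      exact h2.trans (h.later u τ v hu τ' v' hv).le
  have h1 : ∀ l ∈ treeLinks s, ∃ ρ, ρ < R ∧ (2 : ℝ) ^ ρ ≤ G.len l ∧
      G.len l < 2 ^ (ρ + 1) ∧ ActiveAt s (ρ * m) l.1 ∧ ActiveAt s (ρ * m) l.2 := by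
    intro l hl
    obtain ⟨τ, hτ | hτ⟩ := mem_treeLinks.1 hl
    · exact ⟨_, key _ _ _ hτ⟩
    · obtain ⟨a, b, c, d, e⟩ := key _ _ _ hτ
      refine ⟨_, a, ?_, ?_, e, d⟩
      · rwa [Net.len, G.d_comm]
      · rwa [Net.len, G.d_comm]
  choose! ρ hρ using h1
  exact ⟨ρ, hρ⟩

lemma card_treeLinks_fst_le {s : TreeState n} {k : ℕ} (hk : ∀ x, (children s x).card < k)
    (y : Fin n) : ({l ∈ treeLinks s | l.1 = y} : Finset (Link n)).card ≤ k := by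
  have hsub : ({l ∈ treeLinks s | l.1 = y} : Finset (Link n)) ⊆
      -- A node has one link to its parent and one to each child. For the root the default yields
      -- the spurious pair (y, y), harmless in an upper bound.
      insert (y, ((s y).elim y Prod.snd)) ((children s y).image fun u => (y, u)) := by
    rintro ⟨u, v⟩ hl
    obtain ⟨hmem, hy⟩ := Finset.mem_filter.1 hl
    obtain rfl : u = y := hy
    rw [Finset.mem_insert, Finset.mem_image]
    obtain ⟨τ, hτ | hτ⟩ := mem_treeLinks.1 hmem
    · left
      simp only at hτ
      simp [hτ]
    · right
      exact ⟨v, by simp only [children, Finset.mem_filter, Finset.mem_univ, true_and];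
                   exact ⟨τ, hτ⟩, rfl⟩
  refine (Finset.card_le_card hsub).trans ((Finset.card_insert_le _ _).trans ?_)
  have := (Finset.card_image_le (s := children s y) (f := fun u => (y, u)))
  have := hk y
  omega

lemma swap_mem_treeLinks {s : TreeState n} {l : Link n} (h : l ∈ treeLinks s) :
    l.swap ∈ treeLinks s := by
  obtain ⟨τ, hτ⟩ := mem_treeLinks.1 h
  exact mem_treeLinks.2 ⟨τ, hτ.symm⟩

lemma card_treeLinks_snd_le {s : TreeState n} {k : ℕ} (hk : ∀ x, (children s x).card < k)
    (y : Fin n) : ({l ∈ treeLinks s | l.2 = y} : Finset (Link n)).card ≤ k := by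
  refine le_trans ?_ (card_treeLinks_fst_le hk y)
  refine Finset.card_le_card_of_injOn Prod.swap (fun l hl => ?_) Prod.swap_injective.injOn
  obtain ⟨h1, h2⟩ := Finset.mem_filter.1 hl
  exact Finset.mem_coe.2 (Finset.mem_filter.2 ⟨swap_mem_treeLinks h1, h2⟩)

lemma card_treeLinks_le {s : TreeState n} : (treeLinks s).card ≤ 2 * n := by
  have h : (upLinks s).card ≤ n := by
    have : (upLinks s).card ≤ (Finset.univ : Finset (Fin n)).card := by
      refine Finset.card_le_card_of_injOn Prod.fst (fun _ _ => Finset.mem_univ _) ?_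
      rintro ⟨u, v⟩ hl ⟨u', v'⟩ hl' (rfl : u = u')
      obtain ⟨τ, h1⟩ := mem_upLinks.1 hl
      obtain ⟨τ', h2⟩ := mem_upLinks.1 hl'
      rw [h1] at h2
      rw [(Prod.mk.inj (Option.some.inj h2)).2]
    simpa using this
  have h2 : (dual (upLinks s)).card ≤ n := Finset.card_image_le.trans h
  exact (Finset.card_union_le _ _).trans (by omega)

lemma sum_comp_le_card_mul {ι κ : Type*} (F : Finset ι) (V : Finset κ) (f : ι → κ) (h : κ → ℝ)
    (hh : ∀ y, 0 ≤ h y) (hf : ∀ i ∈ F, f i ∈ V) (k : ℕ)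
    (hk : ∀ y ∈ V, (F.filter fun i => f i = y).card ≤ k) :
    ∑ i ∈ F, h (f i) ≤ k * ∑ y ∈ V, h y := by
  rw [← Finset.sum_fiberwise_of_maps_to hf, Finset.mul_sum]
  refine Finset.sum_le_sum fun y hy => ?_
  rw [Finset.sum_congr rfl fun i hi => by rw [(Finset.mem_filter.1 hi).2], Finset.sum_const,
    nsmul_eq_mul]
  exact mul_le_mul_of_nonneg_right (by exact_mod_cast hk y hy) (hh y)

/-- Links whose rounds are `r + J` up to `r + 2 * J` disturb a link of round `r` as little as
links of round `r + J` would disturb each other. -/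
lemma Net.cap_le (G : Net n) (hα : 0 < G.α) {l l' : Link n} {r J : ℕ} (x y : Fin n)
    (hl : 0 < G.len l) (hl1 : G.len l ≤ 2 ^ (r + 1)) (hl' : 0 < G.len l')
    (hl1' : G.len l' ≤ 2 ^ (r + 2 * J + 1)) :
    G.cap l l' x y ≤ max 1 (2 * G.β) * 2 ^ G.α *
      (max 1 (dist (G.pos x) (G.pos y) / 2 ^ (r + J))) ^ (-G.α) := by
  set B := max 1 (2 * G.β) with hB
  set D := G.d x y with hD
  have hD0 : 0 ≤ D := dist_nonneg
  have hB1 : 1 ≤ B := le_max_left _ _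
  have h2 : (1 : ℝ) ≤ 2 ^ G.α := Real.one_le_rpow (by norm_num) hα.le
  -- The geometric mean of 2^(r+1) and 2^(r+2J+1) is 2 · 2^(r+J), twice the separation of the nodes
  -- active at round r + J.
  have hM : (G.len l * G.len l') ^ (G.α / 2) ≤ (2 * 2 ^ (r + J)) ^ G.α := by
    calc (G.len l * G.len l') ^ (G.α / 2)
        ≤ (2 ^ (r + 1) * 2 ^ (r + 2 * J + 1)) ^ (G.α / 2) := by gcongr
      _ = ((2 * 2 ^ (r + J)) ^ (2 : ℝ)) ^ (G.α / 2) := by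
        congr 1
        rw [Real.rpow_two]
        ring
      _ = (2 * 2 ^ (r + J)) ^ G.α := by
        rw [← Real.rpow_mul (by positivity)]
        congr 1
        ring
  have hM0 : 0 < (G.len l * G.len l') ^ (G.α / 2) := by positivity
  have hmax : 0 < max 1 (D / 2 ^ (r + J)) := by positivity
  change (max 1 (D ^ G.α / (B * (G.len l * G.len l') ^ (G.α / 2))))⁻¹ ≤
    B * 2 ^ G.α * (max 1 (D / 2 ^ (r + J))) ^ (-G.α)
  rw [Real.rpow_neg hmax.le, ← div_eq_mul_inv, le_div_iff₀ (by positivity),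
    inv_mul_le_iff₀ (by positivity)]
  set Y := max 1 (D ^ G.α / (B * (G.len l * G.len l') ^ (G.α / 2))) with hY
  have hY1 : 1 ≤ Y := le_max_left _ _
  rcases le_total (D / 2 ^ (r + J)) 1 with h | h
  · rw [max_eq_left h, Real.one_rpow]
    nlinarith [mul_le_mul hB1 h2 (by norm_num) (by linarith)]
  · rw [max_eq_right h, Real.div_rpow hD0 (by positivity), div_le_iff₀ (by positivity)]
    have h3 : D ^ G.α / (B * (G.len l * G.len l') ^ (G.α / 2)) ≤ Y := le_max_right _ _
    rw [div_le_iff₀ (by positivity)] at h3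
    rw [Real.mul_rpow (x := 2) (by norm_num) (by positivity)] at hM
    calc D ^ G.α ≤ Y * (B * (G.len l * G.len l') ^ (G.α / 2)) := h3
      _ ≤ Y * (B * (2 ^ G.α * (2 ^ (r + J)) ^ G.α)) := by gcongr
      _ = Y * (B * 2 ^ G.α) * (2 ^ (r + J)) ^ G.α := by ring

/-- Binary length sorts the gaps between rounds into dyadic classes J ≤ i ≤ 2J; for i = 0 the
integer division gives J = 0. -/
lemma size_bounds (i : ℕ) : 2 ^ i.size / 2 ≤ i ∧ i ≤ 2 * (2 ^ i.size / 2) := by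
  have h1 := Nat.lt_size_self i
  rcases Nat.eq_zero_or_pos i.size with h | h
  · rw [h] at h1
    simp at h1
    simp [h1]
  · obtain ⟨j, hj⟩ := Nat.exists_eq_succ_of_ne_zero h.ne'
    have h2 : 2 ^ j ≤ i := Nat.lt_size.1 (by omega)
    rw [hj, Nat.pow_succ] at h1 ⊢
    omega

/-- The longer links of the tree disturb a link of the tree only a little. -/
lemma exists_conflict_row_bound {α β : ℝ} (hα : 2 < α) :
    ∃ C : ℝ, 0 < C ∧ ∀ (n : ℕ) (G : Net n) (m R k : ℕ) (s : TreeState n),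
      G.α = α → G.β = β → TreeInv G m (R * m) s → G.SepUpTo m (R * m) s →
      (∀ x, (children s x).card < k) → ∀ l ∈ treeLinks s,
      ∑ l' ∈ treeLinks s with G.len l ≤ G.len l', G.conflict l l' ≤ C * k * (R.size + 1) := by
  obtain ⟨C, hC, hpack⟩ := exists_packing_sum hα
  set B := max 1 (2 * β) * 2 ^ α with hB
  have hB0 : 0 < B := by positivity
  refine ⟨4 * (B * C), by positivity, ?_⟩
  intro n G m R k s hGα hGβ hinv hsep hk l hl
  obtain ⟨ρ, hρ⟩ := hinv.exists_round
  set F : Finset (Link n) := {l' ∈ treeLinks s | G.len l ≤ G.len l'} with hF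
  have hFT : ∀ l' ∈ F, l' ∈ treeLinks s := fun l' h => (Finset.mem_filter.1 h).1
  have hlen : ∀ l' ∈ F, ρ l ≤ ρ l' := by
    intro l' hl'
    have h1 := (hρ l hl).2.1
    have h2 := (hρ l' (hFT l' hl')).2.2.1
    have h3 := (Finset.mem_filter.1 hl').2
    have h4 : ρ l < ρ l' + 1 :=
      (pow_lt_pow_iff_right₀ (by norm_num : (1 : ℝ) < 2)).1 (by linarith)
    omega
  -- Grouping by the dyadic class of the gap leaves `R.size + 1` classes, the source of log log Δ;
  -- grouping by the round itself would cost log Δ.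
  set idx : Link n → ℕ := fun l' => (ρ l' - ρ l).size with hidx
  have hmaps : ∀ l' ∈ F, idx l' ∈ Finset.range (R.size + 1) := by
    intro l' hl'
    have h1 := (hρ l' (hFT l' hl')).1
    rw [Finset.mem_range, Nat.lt_succ_iff]
    exact Nat.size_le_size (by omega)
  have hx : ∀ x : Fin n, ∑ l' ∈ F, (G.cap l l' x l'.1 + G.cap l l' x l'.2) ≤
      2 * (B * C) * k * (R.size + 1) := by
    intro x
    rw [← Finset.sum_fiberwise_of_maps_to hmaps]
    have hj : ∀ j ∈ Finset.range (R.size + 1),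
        ∑ l' ∈ F with idx l' = j, (G.cap l l' x l'.1 + G.cap l l' x l'.2) ≤
          2 * (B * C) * k := by
      intro j _
      rcases Finset.eq_empty_or_nonempty (F.filter fun l' => idx l' = j) with he | ⟨l₀, hl₀⟩
      · rw [he, Finset.sum_empty]; positivity
      set J := 2 ^ j / 2 with hJ
      have hround : ∀ l' ∈ F.filter (fun l' => idx l' = j),
          ρ l + J ≤ ρ l' ∧ ρ l' ≤ ρ l + 2 * J := by
        intro l' hl'
        obtain ⟨h1, h2⟩ := Finset.mem_filter.1 hl'
        have h3 := size_bounds (ρ l' - ρ l)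
        have h4 := hlen l' h1
        simp only [hidx] at h2
        rw [h2, ← hJ] at h3
        omega
      -- Both endpoints of every link in the class were active at the start of round ρ l + J, hence
      -- lie in this 2^(ρ l + J)-separated set.
      set V : Finset (Fin n) := {y | ActiveAt s ((ρ l + J) * m) y} with hV
      have hVsep : G.SepAt m (ρ l + J) s := by
        apply hsep
        apply Nat.mul_le_mul_right
        have h1 := (hround l₀ hl₀).1
        have h2 := (hρ l₀ (hFT l₀ (Finset.mem_filter.1 hl₀).1)).1
        omega
      set h : Fin n → ℝ := fun y =>
        (max 1 (dist (G.pos x) (G.pos y) / 2 ^ (ρ l + J))) ^ (-α) with hh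
      have hh0 : ∀ y, 0 ≤ h y := fun y => by simp only [hh]; positivity
      have hsum : ∑ y ∈ V, h y ≤ C := hpack V G.pos (2 ^ (ρ l + J)) (G.pos x) (by positivity)
        fun a ha b hb hab => hVsep a b (by simpa [hV] using ha) (by simpa [hV] using hb) hab
      have hcap : ∀ l' ∈ F.filter (fun l' => idx l' = j), ∀ y, G.cap l l' x y ≤ B * h y := by
        intro l' hl' y
        have h1 := hρ l hl
        have h2 := hρ l' (hFT l' (Finset.mem_filter.1 hl').1)
        have h3 := hround l' hl'
        have h4 := G.cap_le (by linarith) (l := l) (l' := l') (r := ρ l) (J := J) x y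
          (lt_of_lt_of_le (by positivity) h1.2.1) h1.2.2.1.le
          (lt_of_lt_of_le (by positivity) h2.2.1)
          (h2.2.2.1.le.trans (pow_le_pow_right₀ (by norm_num) (by omega)))
        rw [hGα, hGβ] at h4
        exact h4
      have hmem : ∀ l' ∈ F.filter (fun l' => idx l' = j), l'.1 ∈ V ∧ l'.2 ∈ V := by
        intro l' hl'
        have h2 := hρ l' (hFT l' (Finset.mem_filter.1 hl').1)
        have h3 : (ρ l + J) * m ≤ ρ l' * m := Nat.mul_le_mul_right m (hround l' hl').1
        simp only [hV, Finset.mem_filter, Finset.mem_univ, true_and]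
        exact ⟨h2.2.2.2.1.mono h3, h2.2.2.2.2.mono h3⟩
      have e1 := sum_comp_le_card_mul (F.filter fun l' => idx l' = j) V Prod.fst h hh0
        (fun l' hl' => (hmem l' hl').1) k fun y _ =>
          (Finset.card_le_card (by
            intro l' hl'
            simp only [Finset.mem_filter] at hl' ⊢
            exact ⟨hFT l' hl'.1.1, hl'.2⟩)).trans (card_treeLinks_fst_le hk y)
      have e2 := sum_comp_le_card_mul (F.filter fun l' => idx l' = j) V Prod.snd h hh0
        (fun l' hl' => (hmem l' hl').2) k fun y _ =>
          (Finset.card_le_card (by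
            intro l' hl'
            simp only [Finset.mem_filter] at hl' ⊢
            exact ⟨hFT l' hl'.1.1, hl'.2⟩)).trans (card_treeLinks_snd_le hk y)
      calc ∑ l' ∈ F with idx l' = j, (G.cap l l' x l'.1 + G.cap l l' x l'.2)
          ≤ ∑ l' ∈ F with idx l' = j, (B * h l'.1 + B * h l'.2) :=
            Finset.sum_le_sum fun l' hl' => add_le_add (hcap l' hl' _) (hcap l' hl' _)
        _ = B * (∑ l' ∈ F with idx l' = j, h l'.1 + ∑ l' ∈ F with idx l' = j, h l'.2) := by
            rw [Finset.sum_add_distrib, ← Finset.mul_sum, ← Finset.mul_sum, mul_add]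
        _ ≤ B * (k * C + k * C) := by
            refine mul_le_mul_of_nonneg_left (add_le_add ?_ ?_) hB0.le
            · exact e1.trans (mul_le_mul_of_nonneg_left hsum (by positivity))
            · exact e2.trans (mul_le_mul_of_nonneg_left hsum (by positivity))
        _ = 2 * (B * C) * k := by ring
    refine (Finset.sum_le_card_nsmul _ _ _ hj).trans (le_of_eq ?_)
    rw [nsmul_eq_mul, Finset.card_range]
    push_cast
    ring
  simp only [Net.conflict]
  rw [Finset.sum_add_distrib]
  linarith [hx l.1, hx l.2]

/-- In every set of links, the average disturbance is bounded by that caused by longer links. -/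
lemma Net.sum_conflict_le (G : Net n) (T P : Finset (Link n)) (hPT : P ⊆ T) {A : ℝ}
    (hA : ∀ l ∈ T, ∑ l' ∈ T with G.len l ≤ G.len l', G.conflict l l' ≤ A) :
    ∑ l ∈ P, ∑ l' ∈ P.erase l, G.conflict l l' ≤ 2 * A * P.card := by
  have h1 : ∀ l ∈ P, ∑ l' ∈ P with G.len l ≤ G.len l', G.conflict l l' ≤ A := by
    intro l hl
    refine le_trans (Finset.sum_le_sum_of_subset_of_nonneg ?_
      fun l' _ _ => G.conflict_nonneg l l') (hA l (hPT hl))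
    exact Finset.filter_subset_filter _ hPT
  have h2 : ∑ l ∈ P, ∑ l' ∈ P with G.len l ≤ G.len l', G.conflict l l' ≤ A * P.card := by
    refine (Finset.sum_le_card_nsmul _ _ _ h1).trans (le_of_eq ?_)
    rw [nsmul_eq_mul, mul_comm]
  -- Pairs with a shorter second link are the other pairs read backwards, so including them only
  -- doubles the bound.
  have h3 : ∑ l ∈ P, ∑ l' ∈ P with G.len l' ≤ G.len l, G.conflict l l' =
      ∑ l ∈ P, ∑ l' ∈ P with G.len l ≤ G.len l', G.conflict l l' := by
    simp only [Finset.sum_filter]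
    rw [Finset.sum_comm]
    simp only [G.conflict_comm]
  have h4 : ∀ l ∈ P, ∑ l' ∈ P.erase l, G.conflict l l' ≤
      ∑ l' ∈ P with G.len l ≤ G.len l', G.conflict l l' +
        ∑ l' ∈ P with G.len l' ≤ G.len l, G.conflict l l' := by
    intro l _
    simp only [Finset.sum_filter]
    rw [← Finset.sum_add_distrib]
    refine (Finset.sum_le_sum_of_subset_of_nonneg (Finset.erase_subset _ _)
      fun l' _ _ => G.conflict_nonneg l l').trans (Finset.sum_le_sum fun l' _ => ?_)
    have := G.conflict_nonneg l l'
    rcases le_total (G.len l) (G.len l') with h | h <;> rw [if_pos h] <;> split_ifs <;> linarith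
  refine (Finset.sum_le_sum h4).trans ?_
  rw [Finset.sum_add_distrib, h3]
  linarith

/-! ### One slot-pair of the rescheduling -/

/-- Passes from sums over nodes to sums over links. Only the sender of `l` has to be unique; common
senders of other links are absorbed by summing over fibres. -/
lemma Net.receives_of_links (G : Net n) (hN : 0 < G.N) {pow : Link n → ℝ}
    (hpow : ∀ l, 0 ≤ pow l) {X : Finset (Link n)} {l : Link n} (hl : l ∈ X) (hne : l.1 ≠ l.2)
    (hX : ∀ l' ∈ X, l' ≠ l → l'.1 ≠ l.1 ∧ l'.1 ≠ l.2) {I : ℝ}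
    (hI : ∑ l' ∈ X.erase l, pow l' / G.d l'.1 l.2 ^ G.α ≤ I)
    (hβ : G.β * (G.N + I) ≤ pow l / G.d l.1 l.2 ^ G.α) (hβ0 : 0 < G.β) :
    G.Receives (senders X) (nodePower pow X) l.1 l.2 := by
  have hnode : nodePower pow X l.1 = pow l := by
    rw [nodePower, Finset.sum_eq_single l]
    · intro l' hl' hne'
      rw [Finset.mem_filter] at hl'
      exact absurd hl'.2 (hX l' hl'.1 hne').1
    · intro h; exact absurd (Finset.mem_filter.2 ⟨hl, rfl⟩ : l ∈ X.filter fun l' => l'.1 = l.1) h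
  refine ⟨Finset.mem_image_of_mem _ hl, fun h => ?_, ?_⟩
  · obtain ⟨l', hl', h'⟩ := Finset.mem_image.1 h
    by_cases h1 : l' = l
    · rw [h1] at h'; exact hne h'
    · exact (hX l' hl' h1).2 h'
  have hmaps : ∀ l' ∈ X.erase l, l'.1 ∈ (senders X).erase l.1 := by
    intro l' hl'
    obtain ⟨h1, h2⟩ := Finset.mem_erase.1 hl'
    exact Finset.mem_erase.2 ⟨(hX l' h2 h1).1, Finset.mem_image_of_mem _ h2⟩
  have hsum : ∑ w ∈ (senders X).erase l.1, nodePower pow X w / G.d w l.2 ^ G.α =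
      ∑ l' ∈ X.erase l, pow l' / G.d l'.1 l.2 ^ G.α := by
    rw [← Finset.sum_fiberwise_of_maps_to hmaps]
    refine Finset.sum_congr rfl fun w hw => ?_
    rw [nodePower, Finset.sum_div]
    refine Finset.sum_congr ?_ fun l' hl' => by rw [(Finset.mem_filter.1 hl').2]
    ext l'
    simp only [Finset.mem_filter, Finset.mem_erase]
    constructor
    · rintro ⟨h1, h2⟩
      refine ⟨⟨?_, h1⟩, h2⟩
      rintro rfl
      exact (Finset.mem_erase.1 hw).1 h2.symm
    · rintro ⟨⟨_, h1⟩, h2⟩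
      exact ⟨h1, h2⟩
  have hnonneg : 0 ≤ ∑ l' ∈ X.erase l, pow l' / G.d l'.1 l.2 ^ G.α :=
    Finset.sum_nonneg fun l' _ => div_nonneg (hpow l') (Real.rpow_nonneg dist_nonneg _)
  rw [hnode, hsum, le_div_iff₀ (by linarith)]
  refine le_trans ?_ hβ
  gcongr

lemma Net.meanPower_swap (G : Net n) (Γ : ℝ) (l : Link n) :
    G.meanPower Γ l.swap = G.meanPower Γ l := by
  rw [Net.meanPower, Net.meanPower, Prod.fst_swap, Prod.snd_swap, G.d_comm]

/-- If the capped disturbance is less than `1`, it is not capped. -/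
lemma Net.of_cap_lt_one (G : Net n) (hβ : 0 < G.β) (hα : 0 < G.α) {Γ : ℝ} (hΓ : 0 ≤ Γ)
    {l l' : Link n} (hl : 0 < G.len l) (hl' : 0 < G.len l') {x y : Fin n}
    (h : G.cap l l' x y < 1) :
    x ≠ y ∧ G.meanPower Γ l' / G.d y x ^ G.α ≤
      Γ / (2 * G.β * G.len l ^ (G.α / 2)) * G.cap l l' x y := by
  set M := (G.len l * G.len l') ^ (G.α / 2) with hM
  have hM0 : 0 < M := by positivity
  set B := max 1 (2 * G.β) with hB
  have hB0 : 0 < B := by positivity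
  have hgt : 1 < G.d x y ^ G.α / (B * M) := by
    by_contra hcon
    rw [Net.cap, max_eq_left (not_lt.1 hcon), inv_one] at h
    exact lt_irrefl _ h
  have hd : 0 < G.d x y ^ G.α := by
    by_contra hcon
    have : G.d x y ^ G.α / (B * M) ≤ 0 :=
      div_nonpos_of_nonpos_of_nonneg (not_lt.1 hcon) (by positivity)
    linarith
  constructor
  · rintro rfl
    rw [Net.d, dist_self, Real.zero_rpow hα.ne'] at hd
    exact lt_irrefl _ hd
  · have hcap : G.cap l l' x y = B * M / G.d x y ^ G.α := by
      rw [Net.cap, max_eq_right hgt.le, inv_div]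
    have hL : 0 < G.len l ^ (G.α / 2) := by positivity
    rw [hcap, G.d_comm y x, ← mul_div_assoc]
    refine div_le_div_of_nonneg_right ?_ hd.le
    rw [div_mul_eq_mul_div, le_div_iff₀ (by positivity), hM, Real.mul_rpow hl.le hl'.le]
    change Γ * G.len l' ^ (G.α / 2) * _ ≤ _
    have h2 : 2 * G.β ≤ B := le_max_right _ _
    have h3 : 0 ≤ Γ * G.len l' ^ (G.α / 2) * G.len l ^ (G.α / 2) := by positivity
    nlinarith

lemma transmitting_subset {T : Finset (Link n)} {σ : SchedState n} {b : Link n → Bool}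
    {l : Link n} (h : l ∈ transmitting T σ b) : l ∈ T ∧ σ l = none ∧ b l = true := by
  simp only [transmitting, Finset.mem_filter] at h
  exact ⟨h.1, h.2.1⟩

/-- The links completed in a slot-pair. -/
def Net.completed (G : Net n) (pow : Link n → ℝ) (T : Finset (Link n)) (σ : SchedState n)
    (b : Link n → Bool) : Finset (Link n) :=
  G.confirmed pow (acknowledged (G.received pow (transmitting T σ b)))

/-- A drawn link with little disturbance from the other drawn links is completed. -/
lemma Net.mem_completed (G : Net n) (hβ : 0 < G.β) (hα : 0 < G.α) (hN : 0 < G.N) {Γ : ℝ}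
    (hΓ : ∀ u v, u ≠ v → 2 * G.β * G.N * G.d u v ^ G.α ≤ G.meanPower Γ (u, v))
    {T : Finset (Link n)} (hT : ∀ l ∈ T, 0 < G.len l) {σ : SchedState n} {b : Link n → Bool}
    {l : Link n} (hl : l ∈ T) (hσ : σ l = none) (hb : b l = true)
    (hsum : ∑ l' ∈ T with σ l' = none ∧ l' ≠ l ∧ b l' = true, G.conflict l l' < 1) :
    l ∈ G.completed (G.meanPower Γ) T σ b := by
  set D : Finset (Link n) := {l' ∈ T | σ l' = none ∧ l' ≠ l ∧ b l' = true} with hD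
  have hlen := hT l hl
  have hne : l.1 ≠ l.2 := by
    intro h
    rw [Net.len, h, Net.d, dist_self] at hlen
    exact lt_irrefl _ hlen
  have hL : 0 < G.len l ^ (G.α / 2) := by positivity
  have hLL : G.len l ^ G.α = G.len l ^ (G.α / 2) * G.len l ^ (G.α / 2) := by
    rw [← Real.rpow_add hlen, add_halves]
  have hsig := hΓ l.1 l.2 hne
  change 2 * G.β * G.N * G.len l ^ G.α ≤ Γ * G.len l ^ (G.α / 2) at hsig
  have hΓL : 2 * G.β * G.N * G.len l ^ (G.α / 2) ≤ Γ := by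
    rw [hLL, ← mul_assoc] at hsig
    exact le_of_mul_le_mul_right hsig hL
  have hΓ0 : 0 ≤ Γ := le_trans (by positivity) hΓL
  have hpow : ∀ l, 0 ≤ G.meanPower Γ l := fun l =>
    mul_nonneg hΓ0 (Real.rpow_nonneg dist_nonneg _)
  -- The interference budget: β · I is half of the received signal. Admissibility of `Γ` leaves the
  -- other half for β · N.
  set I := Γ / (2 * G.β * G.len l ^ (G.α / 2)) with hI
  have hI0 : 0 ≤ I := by positivity
  have hSINR : G.β * (G.N + I) ≤ G.meanPower Γ l / G.len l ^ G.α := by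
    rw [Net.meanPower, le_div_iff₀ (by positivity)]
    change _ ≤ Γ * G.len l ^ (G.α / 2)
    have h1 : G.β * I * G.len l ^ G.α = Γ * G.len l ^ (G.α / 2) / 2 := by
      rw [hI, hLL]
      field_simp
    nlinarith
  have hcaplt : ∀ l' ∈ D, G.conflict l l' < 1 := fun l' hl' =>
    lt_of_le_of_lt (Finset.single_le_sum (f := fun l' => G.conflict l l')
      (fun l' _ => G.conflict_nonneg l l') hl') hsum
  have hcap : ∀ l' ∈ D, G.cap l l' l.1 l'.1 < 1 ∧ G.cap l l' l.1 l'.2 < 1 ∧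
      G.cap l l' l.2 l'.1 < 1 ∧ G.cap l l' l.2 l'.2 < 1 := by
    intro l' hl'
    have h1 := hcaplt l' hl'
    have h2 := G.cap_nonneg l l'
    have := h2 l.1 l'.1
    have := h2 l.1 l'.2
    have := h2 l.2 l'.1
    have := h2 l.2 l'.2
    unfold Net.conflict at h1
    refine ⟨?_, ?_, ?_, ?_⟩ <;> linarith
  have hDT : ∀ l' ∈ D, 0 < G.len l' := fun l' hl' => hT l' (Finset.mem_filter.1 hl').1
  -- A shared endpoint would give a cap of 1. Thus no drawn link shares a node with `l`: its sender
  -- is not blocked, its receiver is silent, and there is no rival for the acknowledgment.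
  have hsep : ∀ l' ∈ D, l.1 ≠ l'.1 ∧ l.1 ≠ l'.2 ∧ l.2 ≠ l'.1 ∧ l.2 ≠ l'.2 := by
    intro l' hl'
    obtain ⟨h1, h2, h3, h4⟩ := hcap l' hl'
    exact ⟨(G.of_cap_lt_one hβ hα hΓ0 hlen (hDT l' hl') h1).1,
      (G.of_cap_lt_one hβ hα hΓ0 hlen (hDT l' hl') h2).1,
      (G.of_cap_lt_one hβ hα hΓ0 hlen (hDT l' hl') h3).1,
      (G.of_cap_lt_one hβ hα hΓ0 hlen (hDT l' hl') h4).1⟩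
  have hbound : ∀ f : Link n → ℝ, (∀ l' ∈ D, f l' ≤ I * G.conflict l l') → ∀ Y ⊆ D,
      ∑ l' ∈ Y, f l' ≤ I := by
    intro f hf Y hY
    calc ∑ l' ∈ Y, f l' ≤ ∑ l' ∈ Y, I * G.conflict l l' :=
          Finset.sum_le_sum fun l' hl' => hf l' (hY hl')
      _ = I * ∑ l' ∈ Y, G.conflict l l' := by rw [Finset.mul_sum]
      _ ≤ I * ∑ l' ∈ D, G.conflict l l' := mul_le_mul_of_nonneg_left
          (Finset.sum_le_sum_of_subset_of_nonneg hY fun l' _ _ => G.conflict_nonneg l l') hI0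
      _ ≤ I := by nlinarith
  set X := transmitting T σ b with hX
  have hXD : ∀ l' ∈ X, l' ≠ l → l' ∈ D := fun l' hl' hne' => by
    obtain ⟨h1, h2, h3⟩ := transmitting_subset hl'
    exact Finset.mem_filter.2 ⟨h1, h2, hne', h3⟩
  have hlX : l ∈ X := by
    simp only [hX, transmitting, Finset.mem_filter]
    refine ⟨hl, ⟨hσ, hb⟩, fun l' h1 h2 h3 h4 => ?_⟩
    by_contra hne'
    exact (hsep l' (Finset.mem_filter.2 ⟨h1, h2, hne', h3⟩)).1 h4.symm
  have hrec : G.Receives (senders X) (nodePower (G.meanPower Γ) X) l.1 l.2 := by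
    refine G.receives_of_links hN hpow hlX hne (fun l' hl' hne' => ?_)
      (hbound _ (fun l' hl' => ?_) _ fun l' hl' => ?_) hSINR hβ
    · have := hsep l' (hXD l' hl' hne')
      exact ⟨this.1.symm, this.2.2.1.symm⟩
    · refine (G.of_cap_lt_one hβ hα hΓ0 hlen (hDT l' hl') (hcap l' hl').2.2.1).2.trans
        (mul_le_mul_of_nonneg_left ?_ hI0)
      have h2 := G.cap_nonneg l l'
      unfold Net.conflict
      linarith [h2 l.1 l'.1, h2 l.1 l'.2, h2 l.2 l'.1, h2 l.2 l'.2]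
    · obtain ⟨h1, h2⟩ := Finset.mem_erase.1 hl'
      exact hXD l' h2 h1
  set Y := G.received (G.meanPower Γ) X with hY
  have hYX : ∀ l' ∈ Y, l' ∈ X := fun l' h => (Finset.mem_filter.1 h).1
  have hlY : l ∈ Y := Finset.mem_filter.2 ⟨hlX, hrec⟩
  set Z := acknowledged Y with hZ
  have hZY : ∀ l' ∈ Z, l' ∈ Y := fun l' h => (Finset.mem_filter.1 h).1
  have hlZ : l ∈ Z := by
    refine Finset.mem_filter.2 ⟨hlY, pick_eq_some_of_forall_eq (by simpa using hlY) ?_⟩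
    intro u hu
    simp only [Finset.mem_filter, Finset.mem_univ, true_and] at hu
    by_contra hne'
    have h1 : ((u, l.2) : Link n) ≠ l := fun h => hne' (congrArg Prod.fst h)
    exact (hsep _ (hXD _ (hYX _ hu) h1)).2.2.2 rfl
  -- The acknowledgments run on duals of drawn links, so the same conflicts control the second slot
  -- with endpoints exchanged.
  have hZD : ∀ l' ∈ dual Z, l' ≠ l.swap → l'.swap ∈ D := by
    intro l' hl' hne'
    obtain ⟨l'', h1, rfl⟩ := Finset.mem_image.1 hl'
    rw [Prod.swap_swap]
    exact hXD _ (hYX _ (hZY _ h1)) fun h => hne' (by rw [h])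
  refine Finset.mem_filter.2 ⟨hlZ, ?_⟩
  have hSINR' : G.β * (G.N + I) ≤
      G.meanPower Γ l.swap / G.d l.swap.1 l.swap.2 ^ G.α := by
    rw [G.meanPower_swap, Prod.fst_swap, Prod.snd_swap, G.d_comm]
    exact hSINR
  refine G.receives_of_links (l := l.swap) hN hpow (Finset.mem_image_of_mem _ hlZ) hne.symm
    (fun l' hl' hne' => ?_) ?_ hSINR' hβ
  · have := hsep _ (hZD l' hl' hne')
    exact ⟨this.2.2.2.symm, this.2.1.symm⟩
  · have := hbound (fun l' => G.meanPower Γ l' / G.d l'.2 l.1 ^ G.α) (fun l' hl' => ?_)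
      (((dual Z).erase l.swap).image Prod.swap) ?_
    · rw [Finset.sum_image Prod.swap_injective.injOn] at this
      refine le_trans (le_of_eq (Finset.sum_congr rfl fun l' _ => ?_)) this
      rw [G.meanPower_swap, Prod.snd_swap, Prod.snd_swap]
    · refine (G.of_cap_lt_one hβ hα hΓ0 hlen (hDT l' hl') (hcap l' hl').2.1).2.trans
        (mul_le_mul_of_nonneg_left ?_ hI0)
      have h2 := G.cap_nonneg l l'
      unfold Net.conflict
      linarith [h2 l.1 l'.1, h2 l.1 l'.2, h2 l.2 l'.1, h2 l.2 l'.2]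
    · intro l' hl'
      obtain ⟨l'', h1, rfl⟩ := Finset.mem_image.1 hl'
      obtain ⟨h2, h3⟩ := Finset.mem_erase.1 h1
      exact hZD l'' h3 h2

lemma Net.completed_subset (G : Net n) {pow : Link n → ℝ} {T : Finset (Link n)}
    {σ : SchedState n} {b : Link n → Bool} {l : Link n} (h : l ∈ G.completed pow T σ b) :
    l ∈ transmitting T σ b ∧ G.Receives (senders (transmitting T σ b))
      (nodePower pow (transmitting T σ b)) l.1 l.2 := by
  have h1 := (Finset.mem_filter.1 (Finset.mem_filter.1 (Finset.mem_filter.1 h).1).1)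
  exact h1

lemma transmitting_injOn (T : Finset (Link n)) (σ : SchedState n) (b : Link n → Bool) :
    Set.InjOn Prod.fst (transmitting T σ b : Set (Link n)) := by
  intro l hl l' hl' h
  obtain ⟨h1, h2, h3⟩ := transmitting_subset (Finset.mem_coe.1 hl)
  have h4 := Finset.mem_coe.1 hl'
  simp only [transmitting, Finset.mem_filter] at h4
  exact h4.2.2 l h1 h2 h3 h

lemma Net.feasible_completed (G : Net n) (hN : 0 < G.N) {pow : Link n → ℝ}
    (hpow : ∀ l, 0 ≤ pow l) (T : Finset (Link n)) (σ : SchedState n) (b : Link n → Bool) :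
    G.Feasible pow (G.completed pow T σ b) := by
  refine G.feasible_of_receives hN (S := senders (transmitting T σ b))
    (P := nodePower pow (transmitting T σ b)) ?_ ?_ ?_ fun l hl => (G.completed_subset hl).2
  · exact (transmitting_injOn T σ b).mono fun l hl => (G.completed_subset hl).1
  · exact fun l hl => nodePower_eq (transmitting_injOn T σ b) (G.completed_subset hl).1
  · exact fun w => Finset.sum_nonneg fun l _ => hpow l

/-- What holds for every state that the rescheduling can reach in `t` slot-pairs. -/
structure SchedInv (G : Net n) (pow : Link n → ℝ) (T : Finset (Link n)) (t : ℕ)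
    (σ : SchedState n) : Prop where
  lt : ∀ l τ, σ l = some τ → τ < t
  feasible : ∀ τ, G.Feasible pow {l ∈ T | σ l = some τ}

lemma schedInv_zero (G : Net n) (pow : Link n → ℝ) (T : Finset (Link n)) :
    SchedInv G pow T 0 (fun _ => none) := by
  constructor
  · simp
  · intro τ
    simp [Net.Feasible]

/-- A completed link was pending before, so slot `t` receives exactly the completed links and no
earlier slot changes. -/
lemma SchedInv.step {G : Net n} {pow : Link n → ℝ} {T : Finset (Link n)} {t : ℕ}
    {σ : SchedState n} (h : SchedInv G pow T t σ) (hN : 0 < G.N) (hpow : ∀ l, 0 ≤ pow l)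
    (b : Link n → Bool) : SchedInv G pow T (t + 1) (G.schedStep pow T t σ b) := by
  have hdef : ∀ l, G.schedStep pow T t σ b l =
      if l ∈ G.completed pow T σ b then some t else σ l := fun l => rfl
  constructor
  · intro l τ hl
    rw [hdef] at hl
    split_ifs at hl
    · have := Option.some.inj hl; omega
    · have := h.lt l τ hl; omega
  · intro τ
    by_cases hτ : τ = t
    · subst hτ
      convert G.feasible_completed hN hpow T σ b using 1
      ext l
      rw [Finset.mem_filter, hdef]
      constructor
      · rintro ⟨_, h2⟩
        by_contra h3
        rw [if_neg h3] at h2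
        exact lt_irrefl _ (h.lt l τ h2)
      · intro h1
        exact ⟨(transmitting_subset (G.completed_subset h1).1).1, if_pos h1⟩
    · convert h.feasible τ using 1
      ext l
      rw [Finset.mem_filter, Finset.mem_filter, hdef]
      by_cases h1 : l ∈ G.completed pow T σ b
      · rw [if_pos h1, (transmitting_subset (G.completed_subset h1).1).2.1]
        simp [Ne.symm hτ]
      · rw [if_neg h1]

/-! ### Progress of the rescheduling -/

/-- The links of `T` that are not completed yet. -/
def pending (T : Finset (Link n)) (σ : SchedState n) : Finset (Link n) := {l ∈ T | σ l = none}

lemma Net.pending_schedStep (G : Net n) (pow : Link n → ℝ) (T : Finset (Link n)) (t : ℕ)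
    (σ : SchedState n) (b : Link n → Bool) :
    pending T (G.schedStep pow T t σ b) = pending T σ \ G.completed pow T σ b := by
  ext l
  have hdef : G.schedStep pow T t σ b l =
      if l ∈ G.completed pow T σ b then some t else σ l := rfl
  rw [Finset.mem_sdiff, pending, pending, Finset.mem_filter, Finset.mem_filter, hdef]
  by_cases h : l ∈ G.completed pow T σ b <;> simp [h]

/-- The expected number of pending links decreases by a constant fraction of the transmission
probability, if that is small compared to the average disturbance. -/
lemma Net.coinMean_pending_le (G : Net n) (hβ : 0 < G.β) (hα : 0 < G.α) (hN : 0 < G.N) {Γ : ℝ}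
    (hΓ : ∀ u v, u ≠ v → 2 * G.β * G.N * G.d u v ^ G.α ≤ G.meanPower Γ (u, v))
    {T : Finset (Link n)} (hT : ∀ l ∈ T, 0 < G.len l) {A q : ℝ} (hq0 : 0 ≤ q) (hq1 : q ≤ 1)
    (hqA : q * A ≤ 1 / 2)
    (hA : ∀ P ⊆ T, ∑ l ∈ P, ∑ l' ∈ P.erase l, G.conflict l l' ≤ A * P.card)
    (t : ℕ) (σ : SchedState n) :
    coinMean q (fun b => ((pending T (G.schedStep (G.meanPower Γ) T t σ b)).card : ℝ)) ≤
      (1 - q / 2) * (pending T σ).card := by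
  set P := pending T σ with hP
  have hPT : P ⊆ T := Finset.filter_subset _ _
  set w : Link n → Link n → ℝ := fun l l' => if l' ∈ P then G.conflict l l' else 0 with hw
  have hw0 : ∀ l l', 0 ≤ w l l' := by
    intro l l'
    simp only [hw]
    split_ifs
    · exact G.conflict_nonneg l l'
    · exact le_rfl
  set e : Link n → (Link n → Bool) → ℝ := fun l b =>
    if b l = true ∧ (∀ i ∈ (∅ : Finset (Link n)), b i = false) ∧
      ∑ i with i ≠ l ∧ b i = true, w l i < 1 then 1 else 0 with he
  have hle : ∀ b, ((pending T (G.schedStep (G.meanPower Γ) T t σ b)).card : ℝ) ≤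
      P.card - ∑ l ∈ P, e l b := by
    intro b
    have h1 : ∑ l ∈ P, e l b ≤ ((P ∩ G.completed (G.meanPower Γ) T σ b).card : ℝ) := by
      rw [← Finset.filter_mem_eq_inter, Finset.card_filter]
      push_cast
      refine Finset.sum_le_sum fun l hl => ?_
      simp only [he]
      split_ifs with h2 h3 h3
      · exact le_rfl
      · exfalso
        refine h3 (G.mem_completed hβ hα hN hΓ hT (hPT hl) (Finset.mem_filter.1 hl).2 h2.1 ?_)
        refine lt_of_le_of_lt (le_of_eq ?_) h2.2.2
        simp only [hw]
        rw [← Finset.sum_filter, Finset.filter_filter]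
        refine Finset.sum_congr ?_ fun _ _ => rfl
        ext l'
        simp only [hP, pending, Finset.mem_filter, Finset.mem_univ, true_and]
        tauto
      · norm_num
      · exact le_rfl
    rw [G.pending_schedStep, ← hP]
    have h2 := Finset.card_sdiff_add_card_inter P (G.completed (G.meanPower Γ) T σ b)
    have h3 : (((P \ G.completed (G.meanPower Γ) T σ b).card : ℝ) +
      (P ∩ G.completed (G.meanPower Γ) T σ b).card) = P.card := by exact_mod_cast h2
    linarith
  have hprob : ∀ l ∈ P, q * (1 - q * ∑ l' ∈ P.erase l, G.conflict l l') ≤ coinMean q (e l) := by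
    intro l _
    have key := le_coinMean_weight_lt_one hq0 hq1 l ∅ (by simp) (w l) (hw0 l)
    refine le_trans (le_of_eq ?_) key
    have h1 : ∑ i ∈ (insert l (∅ : Finset (Link n)))ᶜ, w l i =
        ∑ l' ∈ P.erase l, G.conflict l l' := by
      simp only [hw]
      rw [← Finset.sum_filter]
      refine Finset.sum_congr ?_ fun _ _ => rfl
      ext l'
      simp
    rw [h1]
    simp
  refine (coinMean_mono hq0 hq1 hle).trans ?_
  rw [coinMean_sub, coinMean_const, coinMean_sum]
  have h1 := Finset.sum_le_sum hprob
  have h2 : ∑ l ∈ P, q * (1 - q * ∑ l' ∈ P.erase l, G.conflict l l') =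
      q * (P.card - q * ∑ l ∈ P, ∑ l' ∈ P.erase l, G.conflict l l') := by
    rw [← Finset.mul_sum, Finset.sum_sub_distrib, ← Finset.mul_sum]
    simp
  -- Individual links may suffer large conflicts; only their average over the pending links matters,
  -- and it costs at most half of the expected successes.
  have h3 : q * ∑ l ∈ P, ∑ l' ∈ P.erase l, G.conflict l l' ≤ P.card / 2 := by
    calc _ ≤ q * (A * P.card) := mul_le_mul_of_nonneg_left (hA P hPT) hq0
      _ = q * A * P.card := by ring
      _ ≤ 1 / 2 * P.card := mul_le_mul_of_nonneg_right hqA (by positivity)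
      _ = P.card / 2 := by ring
  have h4 : q * (P.card / 2 : ℝ) ≤
      q * (P.card - q * ∑ l ∈ P, ∑ l' ∈ P.erase l, G.conflict l l') :=
    mul_le_mul_of_nonneg_left (by linarith) hq0
  rw [h2] at h1
  linarith

/-- The phases before `k` take M (1 + 2 + … + 2^(k-1)) = M (2^k - 1) slot-pairs. -/
lemma contentionProb_eq {M t k : ℕ} (h1 : M * (2 ^ k - 1) ≤ t) (h2 : t < M * (2 ^ (k + 1) - 1)) :
    (contentionProb M t : ℝ) = 1 / (4 * 2 ^ k) := by
  have hM : 0 < M := Nat.pos_of_ne_zero (by rintro rfl; simp at h2)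
  have hlog : Nat.log 2 (t / M + 1) = k := by
    rw [Nat.log_eq_iff (Or.inr ⟨by norm_num, Nat.succ_ne_zero _⟩)]
    have h3 : 2 ^ k - 1 ≤ t / M := by rwa [Nat.le_div_iff_mul_le hM, mul_comm]
    have h4 : t / M < 2 ^ (k + 1) - 1 := Nat.div_lt_of_lt_mul h2
    have := Nat.one_le_two_pow (n := k)
    omega
  change 1 / (4 * (2 : ℝ) ^ Nat.log 2 (t / M + 1)) = _
  rw [hlog]

section run

variable (G : Net n) (pow : Link n → ℝ) (lam : ℝ) (T : Finset (Link n))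

lemma Net.schedRun_support (hN : 0 < G.N) (hpow : ∀ l, 0 ≤ pow l) (K : ℕ) :
    ∀ σ ∈ (G.schedRun pow lam T K).support, SchedInv G pow T K σ := by
  refine chain_support (μ := G.schedRun pow lam T) (I := SchedInv G pow T)
    (κ := fun t σ => (coins (Link n) (contentionProb ⌈4 * lam * Real.log n⌉₊ t)).bind fun b =>
        PMF.pure (G.schedStep pow T t σ b))
    rfl (fun t => rfl) (schedInv_zero G pow T) ?_ K
  intro t σ hσ σ' hσ'
  simp only [PMF.mem_support_bind_iff, PMF.mem_support_pure_iff] at hσ'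
  obtain ⟨b, -, rfl⟩ := hσ'
  exact hσ.step hN hpow b

lemma Net.schedRun_mean_le (K : ℕ) (Φ : ℕ → SchedState n → ℝ) (hΦ : ∀ t σ, 0 ≤ Φ t σ)
    (hstep : ∀ t < K, ∀ σ, coinMean (contentionProb ⌈4 * lam * Real.log n⌉₊ t : ℝ)
      (fun b => Φ (t + 1) (G.schedStep pow T t σ b)) ≤ Φ t σ) :
    mean (G.schedRun pow lam T K) (fun σ => ENNReal.ofReal (Φ K σ)) ≤
      ENNReal.ofReal (Φ 0 fun _ => none) := by
  refine chain_mean_le (μ := G.schedRun pow lam T) (I := fun _ _ => True)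
    (κ := fun t σ => (coins (Link n) (contentionProb ⌈4 * lam * Real.log n⌉₊ t)).bind fun b =>
        PMF.pure (G.schedStep pow T t σ b))
    rfl (fun t => rfl) trivial (fun _ _ _ _ _ => trivial)
    (fun t σ => ENNReal.ofReal (Φ t σ)) K ?_
  intro t ht σ _
  simp only [mean_bind, mean_pure]
  rw [mean_coins _ fun b => hΦ (t + 1) (G.schedStep pow T t σ b)]
  exact ENNReal.ofReal_le_ofReal (hstep t ht σ)

end run

/-- After the phase with transmission probability `1 / (4 * 2 ^ k)`, few links are expected to be
pending. -/
lemma Net.mean_pending_le (G : Net n) (hβ : 0 < G.β) (hα : 0 < G.α) (hN : 0 < G.N) {Γ : ℝ}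
    (hΓ : ∀ u v, u ≠ v → 2 * G.β * G.N * G.d u v ^ G.α ≤ G.meanPower Γ (u, v))
    {T : Finset (Link n)} (hT : ∀ l ∈ T, 0 < G.len l) {A lam : ℝ} {k M : ℕ}
    (hM : M = ⌈4 * lam * Real.log n⌉₊) (hk : A ≤ 2 * 2 ^ k)
    (hA : ∀ P ⊆ T, ∑ l ∈ P, ∑ l' ∈ P.erase l, G.conflict l l' ≤ A * P.card) :
    mean (G.schedRun (G.meanPower Γ) lam T (M * (2 ^ (k + 1) - 1)))
      (fun σ => ENNReal.ofReal ((pending T σ).card : ℝ)) ≤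
      ENNReal.ofReal (T.card * Real.exp (-(M / 8 : ℝ))) := by
  set q : ℝ := 1 / (4 * 2 ^ k) with hq
  have h2k : (1 : ℝ) ≤ 2 ^ k := one_le_pow₀ (by norm_num)
  have hq0 : 0 < q := by positivity
  have hq1 : q ≤ 1 := by
    rw [hq, div_le_one (by positivity)]
    linarith
  have hqA : q * A ≤ 1 / 2 := by
    rw [hq, div_mul_eq_mul_div, div_le_iff₀ (by positivity)]
    linarith
  set K := M * (2 ^ (k + 1) - 1) with hK
  set t₀ := M * (2 ^ k - 1) with ht₀
  have hpk := Nat.one_le_two_pow (n := k)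
  have hKt : K = t₀ + M * 2 ^ k := by
    rw [hK, ht₀, ← Nat.mul_add, pow_succ]
    congr 1
    omega
  set z : ℝ := 1 - q / 2 with hz
  have hz0 : 0 ≤ z := by linarith
  -- Earlier phases are used only for monotonicity of the pending set. Phase `k` gains a factor `z`
  -- in each of its M · 2^k slot-pairs, and M · 2^k · q / 2 = M / 8.
  set Φ : ℕ → SchedState n → ℝ := fun t σ => z ^ (K - max t t₀) * (pending T σ).card with hΦ
  have hmono : ∀ t σ b, (((pending T (G.schedStep (G.meanPower Γ) T t σ b)).card : ℕ) : ℝ) ≤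
      (pending T σ).card := by
    intro t σ b
    rw [G.pending_schedStep]
    exact_mod_cast Finset.card_le_card Finset.sdiff_subset
  have key := G.schedRun_mean_le (G.meanPower Γ) lam T K Φ
    (fun t σ => by simp only [hΦ]; positivity) ?_
  · have e1 : ∀ σ, Φ K σ = (pending T σ).card := by
      intro σ
      simp only [hΦ]
      rw [max_eq_left (by omega), Nat.sub_self, pow_zero, one_mul]
    simp only [e1] at key
    refine key.trans (ENNReal.ofReal_le_ofReal ?_)
    simp only [hΦ]
    rw [max_eq_right (by omega), show K - t₀ = M * 2 ^ k by omega,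
      show pending T (fun _ => none) = T by simp [pending], mul_comm]
    refine mul_le_mul_of_nonneg_left ?_ (by positivity)
    have h1 : z ≤ Real.exp (-(q / 2)) := by
      have := Real.add_one_le_exp (-(q / 2))
      linarith
    refine (pow_le_pow_left₀ hz0 h1 _).trans (le_of_eq ?_)
    rw [← Real.exp_nat_mul]
    congr 1
    push_cast
    rw [hq]
    field_simp
    ring
  intro t ht σ
  have hp := (contentionProb ⌈4 * lam * Real.log n⌉₊ t).2
  by_cases h : t < t₀
  · have e2 : K - max (t + 1) t₀ = K - max t t₀ := by
      rw [max_eq_right (by omega), max_eq_right (by omega)]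
    simp only [hΦ, e2]
    rw [coinMean_const_mul]
    refine mul_le_mul_of_nonneg_left ?_ (by positivity)
    refine (coinMean_mono hp.1 hp.2 fun b => hmono t σ b).trans ?_
    rw [coinMean_const]
  · have e2 : K - max t t₀ = K - max (t + 1) t₀ + 1 := by
      rw [max_eq_left (by omega), max_eq_left (by omega)]
      omega
    simp only [hΦ, e2]
    have h1 := G.coinMean_pending_le hβ hα hN hΓ hT hq0.le hq1 hqA hA t σ
    rw [coinMean_const_mul, ← hM, contentionProb_eq (k := k) (not_lt.1 h) ht, ← hq]
    calc _ ≤ z ^ (K - max (t + 1) t₀) * (z * (pending T σ).card) :=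
          mul_le_mul_of_nonneg_left h1 (by positivity)
      _ = z ^ (K - max (t + 1) t₀ + 1) * (pending T σ).card := by ring

/-! ### The number of slots -/

lemma one_half_le_log {n : ℕ} (hn : 2 ≤ n) : 1 / 2 ≤ Real.log n := by
  have h1 : Real.log 2 ≤ Real.log n := Real.log_le_log (by norm_num) (by exact_mod_cast hn)
  linarith [Real.log_two_gt_d9]

lemma Net.log_le_Upsilon (G : Net n) : Real.log n ≤ G.Upsilon := by
  unfold Net.Upsilon
  linarith [le_max_right (Real.log (Real.log G.Delta)) 0]

/-- The number of rounds is O(1 + log Δ), so its binary length is O(1 + log log Δ); additive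
constants are absorbed by log n ≥ 1/2. -/
lemma Net.size_rounds_le (G : Net n) (hn : 2 ≤ n) (hΔ : 1 ≤ G.Delta) :
    (G.rounds.size + 1 : ℝ) ≤ 12 * G.Upsilon := by
  have hlog := one_half_le_log hn
  have hl2 := Real.log_two_gt_d9
  set x := Real.log G.Delta with hx
  have hx0 : 0 ≤ x := Real.log_nonneg hΔ
  have hR : (G.rounds : ℝ) ≤ 2 * x + 1 := by
    have h1 : 2 ^ Nat.log 2 ⌊G.Delta⌋₊ ≤ ⌊G.Delta⌋₊ :=
      Nat.pow_log_le_self 2 (Nat.floor_pos.2 hΔ).ne'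
    have h2 : (2 : ℝ) ^ Nat.log 2 ⌊G.Delta⌋₊ ≤ G.Delta :=
      le_trans (by exact_mod_cast h1) (Nat.floor_le (by linarith))
    have h3 := Real.log_le_log (by positivity) h2
    rw [Real.log_pow, ← hx] at h3
    have h4 : (0 : ℝ) ≤ Nat.log 2 ⌊G.Delta⌋₊ := by positivity
    rw [Net.rounds]
    push_cast
    nlinarith
  have hsize : ((G.rounds.size : ℝ) - 1) * Real.log 2 ≤ Real.log (2 * x + 1) := by
    obtain ⟨j, hj⟩ : ∃ j, G.rounds.size = j + 1 :=
      Nat.exists_eq_succ_of_ne_zero (Nat.size_pos.2 (Nat.succ_pos _)).ne'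
    have h1 : 2 ^ j ≤ G.rounds := Nat.lt_size.1 (by omega)
    have h2 : (2 : ℝ) ^ j ≤ 2 * x + 1 := le_trans (by exact_mod_cast h1) hR
    have h3 := Real.log_le_log (by positivity) h2
    rw [Real.log_pow] at h3
    rw [hj]
    push_cast
    linarith
  have hloglog : Real.log (2 * x + 1) ≤ 2 + max (Real.log x) 0 := by
    have h3 : Real.log 3 ≤ 2 := by linarith [Real.log_le_sub_one_of_pos (x := 3) (by norm_num)]
    rcases le_total x 1 with h | h
    · have := Real.log_le_log (by linarith) (show 2 * x + 1 ≤ 3 by linarith)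
      linarith [le_max_right (Real.log x) 0]
    · have h4 := Real.log_le_log (by linarith) (show 2 * x + 1 ≤ 3 * x by linarith)
      rw [Real.log_mul (by norm_num) (by linarith)] at h4
      linarith [le_max_left (Real.log x) 0]
  have hmax := le_max_right (Real.log x) 0
  unfold Net.Upsilon
  rw [← hx]
  rcases le_total (1 : ℝ) G.rounds.size with h | h
  · nlinarith
  · linarith

lemma one_sub_pow_le_rpow {c x : ℝ} (hc : c ≤ 1) {m : ℕ} (hn : 0 < n) (hm : x ≤ c * m / Real.log n)
    (hlog : 0 < Real.log n) : (1 - c) ^ m ≤ (n : ℝ) ^ (-x) := by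
  have h1 : 1 - c ≤ Real.exp (-c) := by linarith [Real.add_one_le_exp (-c)]
  have hn' : (0 : ℝ) < n := by exact_mod_cast hn
  calc (1 - c) ^ m ≤ Real.exp (-c) ^ m := pow_le_pow_left₀ (by linarith) h1 m
    _ = Real.exp (-(c * m)) := by rw [← Real.exp_nat_mul]; congr 1; ring
    _ ≤ Real.exp (Real.log n * (-x)) := by
      rw [le_div_iff₀ hlog] at hm
      exact Real.exp_le_exp.2 (by linarith)
    _ = (n : ℝ) ^ (-x) := (Real.rpow_def_of_pos hn' _).symm

lemma log_le_logb_two {n : ℕ} (hn : 2 ≤ n) : Real.log n ≤ Real.logb 2 n := by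
  have hl2 : Real.log 2 < 1 := by linarith [Real.log_two_lt_d9]
  have hl2' : 0 < Real.log 2 := Real.log_pos (by norm_num)
  have := one_half_le_log hn
  rw [Real.logb, le_div_iff₀ hl2']
  nlinarith

/-- The sum of the bounds on the failure probabilities. -/
lemma fail_prob_le {a c lam₁ lam₂ : ℝ} (ha0 : 0 < a) (ha1 : a ≤ 1) (hn : 2 ≤ n)
    (h₁ : (2 * |c| + 8) / a ≤ lam₁) (h₂ : (2 * |c| + 8) / a ≤ lam₂) {m k M : ℕ}
    (hm : lam₁ * Real.log n ≤ m) (hk : (|c| + 4) / a * Real.log n ≤ k)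
    (hM : 4 * lam₂ * Real.log n ≤ M) :
    n ^ 2 * (1 - a) ^ m + n * (1 - a) ^ k + 2 * n * Real.exp (-(M / 8 : ℝ)) ≤
      (n : ℝ) ^ (-c) := by
  have hlog : 0 < Real.log n := by linarith [one_half_le_log hn]
  have hn1 : (2 : ℝ) ≤ n := by exact_mod_cast hn
  have hn0 : (0 : ℝ) < n := by linarith
  have habs := abs_nonneg c
  have hca := le_abs_self c
  rw [div_le_iff₀ ha0] at h₁ h₂
  -- Of the exponent 4, two powers cancel the largest prefactor n², and two give 1/n² ≤ 1/4, leaving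
  -- room for all three terms.
  set y : ℝ := (n : ℝ) ^ (-(|c| + 4)) with hy
  have hy0 : 0 < y := by positivity
  have e1 : (1 - a) ^ m ≤ y := by
    refine one_sub_pow_le_rpow ha1 (by omega) ?_ hlog
    rw [le_div_iff₀ hlog]
    have := mul_le_mul_of_nonneg_left hm ha0.le
    nlinarith
  have e2 : (1 - a) ^ k ≤ y := by
    refine one_sub_pow_le_rpow ha1 (by omega) ?_ hlog
    rw [le_div_iff₀ hlog]
    have := mul_le_mul_of_nonneg_left hk ha0.le
    rwa [← mul_assoc, mul_div_cancel₀ _ ha0.ne'] at this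
  have e3 : Real.exp (-(M / 8 : ℝ)) ≤ y := by
    rw [hy, Real.rpow_def_of_pos hn0]
    apply Real.exp_le_exp.2
    have h3 : 2 * |c| + 8 ≤ lam₂ := by
      have : 0 ≤ lam₂ := by
        by_contra hcon
        push Not at hcon
        nlinarith
      nlinarith
    nlinarith
  have hfin : (n : ℝ) ^ 2 * y ≤ (n : ℝ) ^ (-c) / 4 := by
    have h4 : (n : ℝ) ^ 2 * y = (n : ℝ) ^ (-|c|) * ((n : ℝ) ^ 2)⁻¹ := by
      rw [hy, ← Real.rpow_natCast, ← Real.rpow_neg hn0.le, ← Real.rpow_add hn0,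
        ← Real.rpow_add hn0]
      congr 1
      push_cast
      ring
    rw [h4, div_eq_mul_inv]
    refine mul_le_mul (Real.rpow_le_rpow_of_exponent_le (by linarith) (by linarith)) ?_
      (by positivity) (by positivity)
    exact inv_anti₀ (by norm_num) (by nlinarith)
  have f1 : (n : ℝ) ^ 2 * (1 - a) ^ m ≤ n ^ 2 * y := by gcongr
  have f2 : (n : ℝ) * (1 - a) ^ k ≤ n ^ 2 * y := by
    calc (n : ℝ) * (1 - a) ^ k ≤ n * y := by gcongr
      _ ≤ n ^ 2 * y := by gcongr; nlinarith
  have f3 : 2 * n * Real.exp (-(M / 8 : ℝ)) ≤ n ^ 2 * y := by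
    calc 2 * n * Real.exp (-(M / 8 : ℝ)) ≤ 2 * n * y := by gcongr
      _ ≤ n ^ 2 * y := by gcongr; nlinarith
  have hpos : 0 < (n : ℝ) ^ (-c) := by positivity
  linarith

/-- The number of slots used, up to the phase with transmission probability `1 / (4 * 2 ^ j)`. -/
lemma slot_count_le {U L A lam κ C₁ S : ℝ} {k M j : ℕ} (hL : 1 / 2 ≤ L) (hU : L ≤ U)
    (hlam : 0 ≤ lam) (hκ : 0 ≤ κ) (hC : 0 ≤ C₁) (hk : (k : ℝ) ≤ κ * L + 1)
    (hM : (M : ℝ) ≤ 4 * lam * L + 1) (hS : S ≤ 12 * U) (hA : A = 2 * (C₁ * k * S))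
    (hj : (2 : ℝ) ^ j ≤ max A 1) (hA0 : 0 ≤ A) :
    (2 * (M * (2 ^ (j + 1) - 1) : ℕ) : ℝ) ≤
      8 * (4 * lam + 2) * (24 * C₁ * (κ + 2) + 4) * U * L ^ 3 := by
  have hk' : (k : ℝ) ≤ (κ + 2) * L := by linarith
  have hM' : (M : ℝ) ≤ (4 * lam + 2) * L := by linarith
  have hU0 : 0 < U := by linarith
  have hL0 : 0 < L := by linarith
  have hUL : 1 ≤ 4 * (U * L) := by nlinarith
  have hA1 : A ≤ 24 * C₁ * (κ + 2) * (U * L) := by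
    calc A = 2 * (C₁ * k * S) := hA
      _ ≤ 2 * (C₁ * k * (12 * U)) := by gcongr
      _ ≤ 2 * (C₁ * ((κ + 2) * L) * (12 * U)) := by gcongr
      _ = 24 * C₁ * (κ + 2) * (U * L) := by ring
  have hj' : (2 : ℝ) ^ j ≤ (24 * C₁ * (κ + 2) + 4) * (U * L) := by
    refine hj.trans (max_le ?_ ?_)
    · linarith
    · have : 0 ≤ 24 * C₁ * (κ + 2) * (U * L) := by positivity
      linarith
  have h1 : ((M * (2 ^ (j + 1) - 1) : ℕ) : ℝ) ≤ M * (2 * 2 ^ j) := by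
    have : M * (2 ^ (j + 1) - 1) ≤ M * (2 * 2 ^ j) :=
      Nat.mul_le_mul_left _ (by rw [pow_succ]; omega)
    exact_mod_cast this
  calc (2 * (M * (2 ^ (j + 1) - 1) : ℕ) : ℝ) ≤ 2 * (M * (2 * 2 ^ j)) := by linarith
    _ ≤ 2 * (((4 * lam + 2) * L) * (2 * ((24 * C₁ * (κ + 2) + 4) * (U * L)))) := by gcongr
    _ = 4 * (4 * lam + 2) * (24 * C₁ * (κ + 2) + 4) * U * L ^ 2 := by ring
    -- The count is in fact of order U L²; the extra factor 2L ≥ 1 only weakens it.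
    _ ≤ 4 * (4 * lam + 2) * (24 * C₁ * (κ + 2) + 4) * U * (2 * L ^ 3) := by
      gcongr
      nlinarith [sq_nonneg L]
    _ = 8 * (4 * lam + 2) * (24 * C₁ * (κ + 2) + 4) * U * L ^ 3 := by ring

/-! ### The two algorithms together -/

lemma ofReal_one_sub_le_toOuterMeasure {Ω : Type*} (μ : PMF Ω) (A : Set Ω) {δ : ℝ}
    (hδ0 : 0 ≤ δ) (h : μ.toOuterMeasure Aᶜ ≤ ENNReal.ofReal δ) :
    ENNReal.ofReal (1 - δ) ≤ μ.toOuterMeasure A := by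
  have h1 : μ.toOuterMeasure A + μ.toOuterMeasure Aᶜ = 1 := by
    rw [toOuterMeasure_eq_mean, toOuterMeasure_eq_mean, ← mean_add]
    have : ∀ x, A.indicator (fun _ => (1 : ENNReal)) x + Aᶜ.indicator (fun _ => 1) x = 1 :=
      fun x => Set.indicator_self_add_compl_apply A _ x
    simp only [this, mean_const]
  rw [ENNReal.ofReal_sub _ hδ0, ENNReal.ofReal_one, tsub_le_iff_right, ← h1]
  exact add_le_add_right h _

/-- If all links are likely to be completed for every good tree, then the whole construction is
likely to succeed. -/
lemma Net.initAndReschedule_fail_le (G : Net n) (p : unitInterval) (lam₁ lam₂ Γ : ℝ) (K : ℕ)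
    (B : Set (TreeState n)) (E : Set (TreeState n × SchedState n)) {δ₁ δ₂ : ENNReal}
    (hB : (G.init p lam₁).toOuterMeasure B ≤ δ₁)
    (h : ∀ s ∈ (G.init p lam₁).support, s ∉ B →
      mean (G.schedRun (G.meanPower Γ) lam₂ (treeLinks s) K)
        (fun σ => E.indicator (fun _ => 1) (s, σ)) ≤ δ₂) :
    (G.initAndReschedule p lam₁ lam₂ Γ K).toOuterMeasure E ≤ δ₁ + δ₂ := by
  rw [toOuterMeasure_eq_mean, Net.initAndReschedule]
  simp only [mean_bind, mean_pure]
  refine (mean_mono_of_support _ (g := fun s => B.indicator (fun _ => 1) s + δ₂)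
    fun s hs => ?_).trans ?_
  · by_cases hsB : s ∈ B
    · rw [Set.indicator_of_mem hsB]
      refine le_trans ?_ (le_add_right le_rfl)
      refine (mean_mono_of_support _ (g := fun _ => 1) fun σ _ => ?_).trans (mean_const _ _).le
      exact Set.indicator_le_self' (fun _ _ => zero_le) _
    · exact (h s hs hsB).trans (le_add_left le_rfl)
  · rw [mean_add, mean_const, ← toOuterMeasure_eq_mean]
    exact add_le_add_left hB _

end SINR

end

/-! ### Choice of the constants, and combination of the two failure probabilities -/

theorem theorem2 (α β c : ℝ) (hα : 2 < α) (hβ : 0 < β)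
    (p : unitInterval) (hp₀ : 0 < (p : ℝ)) (hp : (p : ℝ) ≤ 1 / 2) :
    ∃ lam₀ : ℝ, ∀ lam₁ lam₂ : ℝ, lam₀ ≤ lam₁ → lam₀ ≤ lam₂ → ∃ C : ℝ,
      ∀ (n : ℕ) (G : SINR.Net n) (Γ : ℝ),
        0 < n → G.α = α → G.β = β → 0 < G.N →
        (∀ u v, u ≠ v → 1 ≤ G.d u v) →
        (∀ u v, u ≠ v → 2 * G.β * G.N * G.d u v ^ G.α ≤ G.meanPower Γ (u, v)) →
        ∃ K : ℕ, (2 * K : ℝ) ≤ C * G.Upsilon * Real.log n ^ 3 ∧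
          ENNReal.ofReal (1 - (n : ℝ) ^ (-c)) ≤
            (G.initAndReschedule p lam₁ lam₂ Γ K).toOuterMeasure
              {ω | SINR.IsBiTree G (SINR.upLinks ω.1) (SINR.stamp ω.1)
                    (fun t _ => G.roundPower (t / SINR.pairsPerRound n lam₁ + 1)) ∧
                  G.IsSchedule (G.meanPower Γ) (SINR.treeLinks ω.1) K ω.2} := by
  obtain ⟨a, ha0, ha1, hstep⟩ := SINR.exists_success_prob hα hβ hp₀ hp
  obtain ⟨C₁, hC₁, hrow⟩ := SINR.exists_conflict_row_bound (β := β) hα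
  set κ : ℝ := (|c| + 4) / a with hκ
  have hκ0 : 0 ≤ κ := by positivity
  refine ⟨(2 * |c| + 8) / a, fun lam₁ lam₂ h₁ h₂ =>
    ⟨8 * (4 * lam₂ + 2) * (24 * C₁ * (κ + 2) + 4), ?_⟩⟩
  intro n G Γ hn hGα hGβ hN hsep hΓ
  have hlam₁ : 0 ≤ lam₁ := le_trans (by positivity) h₁
  have hlam₂ : 0 ≤ lam₂ := le_trans (by positivity) h₂
  -- For n = 1 the slot bound is 0, so K = 0 is forced; the required probability 1 - 1^(-c) is 0 as
  -- well.
  rcases Nat.lt_or_ge n 2 with hn2 | hn2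
  · obtain rfl : n = 1 := by omega
    exact ⟨0, by simp, by simp⟩
  have hα0 : 0 < G.α := by rw [hGα]; linarith
  have hβ0 : 0 < G.β := by rw [hGβ]; exact hβ
  have hlog := SINR.one_half_le_log hn2
  have huv : (⟨0, hn⟩ : Fin n) ≠ ⟨1, hn2⟩ := by simp
  have hΔ : 1 ≤ G.Delta := (hsep _ _ huv).trans (G.d_le_Delta _ _)
  have hΓ0 : 0 ≤ Γ := by
    have h3 := hsep _ _ huv
    have h4 := hΓ _ _ huv
    by_contra hcon
    have h5 : G.meanPower Γ (⟨0, hn⟩, ⟨1, hn2⟩) ≤ 0 :=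
      mul_nonpos_of_nonpos_of_nonneg (not_le.1 hcon).le (Real.rpow_nonneg dist_nonneg _)
    have h6 : 0 < 2 * G.β * G.N * G.d ⟨0, hn⟩ ⟨1, hn2⟩ ^ G.α := by positivity
    linarith
  have hpow : ∀ l, 0 ≤ G.meanPower Γ l := fun l =>
    mul_nonneg hΓ0 (Real.rpow_nonneg dist_nonneg _)
  set m := SINR.pairsPerRound n lam₁ with hm
  set k : ℕ := ⌈κ * Real.log n⌉₊ with hk
  set M : ℕ := ⌈4 * lam₂ * Real.log n⌉₊ with hM
  set A : ℝ := 2 * (C₁ * k * (G.rounds.size + 1)) with hA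
  have hA0 : 0 ≤ A := by positivity
  -- The last phase needed: 2^(j+1) > A makes q = 1/(4 · 2^j) at most 1/(2A), while 2^j ≤ max(A, 1)
  -- bounds the slots.
  obtain ⟨j, hj1, hj2⟩ := exists_nat_pow_near (le_max_right A 1) (one_lt_two)
  have hAj : A ≤ 2 * 2 ^ j := by
    rw [pow_succ] at hj2
    linarith [le_max_left A 1]
  refine ⟨M * (2 ^ (j + 1) - 1), ?_, ?_⟩
  · exact SINR.slot_count_le hlog G.log_le_Upsilon hlam₂ hκ0 hC₁.le
      (Nat.ceil_lt_add_one (by positivity)).le (Nat.ceil_lt_add_one (by positivity)).le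
      (G.size_rounds_le hn2 hΔ) hA hj1 hA0
  have hfail := SINR.fail_prob_le (c := c) ha0 ha1.le hn2 h₁ h₂ (m := m) (k := k) (M := M)
    ((mul_le_mul_of_nonneg_left (SINR.log_le_logb_two hn2) hlam₁).trans (Nat.le_ceil _))
    (Nat.le_ceil _) (Nat.le_ceil _)
  have hbound : G.StepBound p a := fun r t s u v => hstep n G r t s u v hGα hGβ hN
  apply SINR.ofReal_one_sub_le_toOuterMeasure _ _ (by positivity)
  have ha2 : 0 ≤ 1 - a := by linarith
  refine le_trans ?_ (ENNReal.ofReal_le_ofReal hfail)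
  rw [ENNReal.ofReal_add (by positivity) (by positivity)]
  refine G.initAndReschedule_fail_le p lam₁ lam₂ Γ _ _ _
    (G.tree_fail_prob hn p ha0.le ha1.le hbound hsep m k) ?_
  intro s hs hsB
  obtain ⟨hsepU, hchild⟩ : G.SepUpTo m (G.rounds * m) s ∧
      ∀ x, (SINR.children s x).card < k := by
    by_contra hcon
    exact hsB hcon
  have hinv := G.treeRun_support hn p m (G.rounds * m) s hs
  have hT : ∀ l ∈ SINR.treeLinks s, 0 < G.len l := by
    obtain ⟨ρ, hρ⟩ := hinv.exists_round
    exact fun l hl => lt_of_lt_of_le (by positivity) (hρ l hl).2.1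
  have hbi := hinv.isBiTree hβ0 hN fun u v => hsepU.eq_of_active
  have havg : ∀ P ⊆ SINR.treeLinks s,
      ∑ l ∈ P, ∑ l' ∈ P.erase l, G.conflict l l' ≤ A * P.card := fun P hP =>
    G.sum_conflict_le _ P hP (hrow n G m G.rounds k s hGα hGβ hinv hsepU hchild)
  -- Markov's inequality: on a good tree, failure means that at least one link is pending, so its
  -- indicator is at most the number of pending links.
  refine (SINR.mean_mono_of_support _ fun σ hσ => ?_).trans
    ((G.mean_pending_le hβ0 hα0 hN hΓ hT hM hAj havg).trans (ENNReal.ofReal_le_ofReal ?_))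
  · have hinv' := G.schedRun_support (G.meanPower Γ) lam₂ (SINR.treeLinks s) hN hpow _ σ hσ
    by_cases hpend : SINR.pending (SINR.treeLinks s) σ = ∅
    · rw [Set.indicator_of_notMem]
      · exact zero_le
      · rw [Set.mem_compl_iff, not_not]
        refine ⟨hbi, fun l hl => ?_, fun t _ => hinv'.feasible t⟩
        have h3 : σ l ≠ none := fun h4 => by
          have : l ∈ SINR.pending (SINR.treeLinks s) σ := Finset.mem_filter.2 ⟨hl, h4⟩
          simp [hpend] at this
        obtain ⟨t, ht⟩ := Option.ne_none_iff_exists'.1 h3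
        exact ⟨t, hinv'.lt l t ht, ht⟩
    · refine (Set.indicator_le_self' (fun _ _ => zero_le) _).trans ?_
      have h3 := Finset.card_pos.2 (Finset.nonempty_iff_ne_empty.2 hpend)
      rw [ENNReal.ofReal_natCast]
      exact_mod_cast h3
  · gcongr
    exact_mod_cast SINR.card_treeLinks_le
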